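/- **Setting.** Let $N\ge 2$ and $\mathcal N=\{1,\dots,N\}$. Player $i$ has action $x_i\in\mathbb R$ and cost $f_i:\mathbb R^N\to\mathbb R$, and its dynamics are $\dot x_i=u_i+g_i(\mathbf x)+d_i(t)$ for $t\ge t_0$. Assume: (1) each $f_i$ is twice continuously differentiable; (2) there is $m>0$ with $(\mathbf x-\mathbf z)^T(\Upsilon(\mathbf x)-\Upsilon(\mathbf z))\ge m\|\mathbf x-\mathbf z\|^2$ for all $\mathbf x,\mathbf z\in\mathbb R^N$, where $\Upsilon(\mathbf x)=(\frac{\partial f_1}{\partial x_1}(\mathbf x),\dots,\frac{\partial f_N}{\partial x_N}(\mathbf x))^T$; (3) $(a_{ij})$ is the weight matrix of an undirected connected graph on $\mathcal N$, that is, $a_{ij}=a_{ji}\ge 0$, $a_{ii}=0$, and the graph whose edges are the pairs with $a_{ij}>0$ is connected; (4) each $g_i:\mathbb R^N\to\mathbb R$ is twice continuously differentiable (so its first and second partial derivatives are bounded on bounded sets), and each $d_i$ is twice continuously differentiable on $[t_0,\infty)$ with $\dot d_i$ and $\ddot d_i$ bounded there. Fix $\bar\theta_{ij}>0$. For gains $\theta,k_i^s,c_i,\beta_i>0$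 consider the closed loop of the players' dynamics with $$u_i=-\tfrac{\partial f_i}{\partial x_i}(\mathbf y_i)-\hat z_i,\qquad \mathbf y_i=(y_{i1},\dots,y_{iN})^T,$$ $$\dot y_{ij}=-\theta\bar\theta_{ij}\Big(\sum_{k=1}^N a_{ik}(y_{ij}-y_{kj})+a_{ij}(y_{ij}-x_j)\Big),$$ $$\dot{\hat x}_i=u_i+\hat z_i+(k_i^s+c_i)(x_i-\hat x_i),\qquad \dot{\hat z}_i=k_i^sc_i(x_i-\hat x_i)+\beta_i\,\mathrm{sgn}(x_i-\hat x_i),$$ where solutions are understood in the sense of Filippov ($\hat z_i$ is locally absolutely continuous and satisfies its equation for almost every $t$ with some value in $[-1,1]$ in place of $\mathrm{sgn}(0)$). For a Nash equilibrium $\mathbf x^*$ (that is, $f_i(x_i^*,\mathbf x_{-i}^*)\le f_i(s,\mathbf x_{-i}^*)$ for all $i$ and $s\in\mathbb R$) put $\zeta_{i1}=x_i-\hat x_i$, $\zeta_{i2}=g_i(\mathbf x)+d_i(t)-\hat z_i$, $\xi_i=x_i-x_i^*$, $\eta_{ij}=y_{ij}-x_j$, $\gamma_i=\dot\zeta_{i1}+c_i\zeta_{i1}$,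 and let $\mathcal E_f=[\zeta_1^T,\zeta_2^T,\xi^T,\eta^T,\gamma^T]^T$ be the concatenated error vector, with the Euclidean norm. **Theorem.** The game has exactly one Nash equilibrium $\mathbf x^*$. Moreover, for every $v_1>0$ there is $\theta^*(v_1)>0$ such that for each $\theta>\theta^*$ there is $k_s^r(v_1,\theta)>0$ such that for all $k_i^s>k_s^r$ ($i\in\mathcal N$) there is $c^r(v_1,\theta,k_s)>0$ such that for all $c_i>c^r$ ($i\in\mathcal N$) there is $\beta^r(v_1,\theta,k_s,c)>0$ such that for all $\beta_i>\beta^r$ ($i\in\mathcal N$) the following holds for the solutions with $\|\mathcal E_f(t_0)\|\le v_1$: along every solution on a finite interval $[t_0,T)$, $\mathcal E_f$ stays bounded (no finite escape time), and along every solution on $[t_0,\infty)$, $$\|\mathcal E_f(t)\|\to 0\quad\text{as } t\to\infty .$$ In particular $\mathbf x(t)\to\mathbf x^*$ and $\hat z_i(t)-g_i(\mathbf x(t))-d_i(t)\to 0$ for all $i$. -/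

import Mathlib

namespace RISE

/-- `∂f_i/∂x_i` evaluated at `x`. -/
noncomputable def partialOwn {N : ℕ} (f : Fin N → (Fin N → ℝ) → ℝ) (i : Fin N)
    (x : Fin N → ℝ) : ℝ :=
  fderiv ℝ (f i) x (Pi.single i 1)

/-- The pseudo-gradient `Υ(x) = [∂f_i/∂x_i (x)]_vec`. -/
noncomputable def pseudoGradient {N : ℕ} (f : Fin N → (Fin N → ℝ) → ℝ)
    (x : Fin N → ℝ) : Fin N → ℝ :=
  fun i => partialOwn f i x

/-- `xs` is a Nash equilibrium: no player can lower its cost by changing its own action only. -/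
def IsNash {N : ℕ} (f : Fin N → (Fin N → ℝ) → ℝ) (xs : Fin N → ℝ) : Prop :=
  ∀ (i : Fin N) (s : ℝ), f i xs ≤ f i (Function.update xs i s)

/-- The graph on the players whose edges are the pairs with positive weight. -/
def commGraph {N : ℕ} (a : Matrix (Fin N) (Fin N) ℝ) : SimpleGraph (Fin N) :=
  SimpleGraph.fromRel fun i j => 0 < a i j

/-- `a` is the adjacency (weight) matrix of an undirected connected communication graph. -/
structure IsUndirectedConnected {N : ℕ} (a : Matrix (Fin N) (Fin N) ℝ) : Prop where
  nonneg : ∀ i j, 0 ≤ a i j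
  diag : ∀ i, a i i = 0
  symm : ∀ i j, a i j = a j i
  connected : (commGraph a).Connected

/-- The convexified signum: `{sgn r}` for `r ≠ 0`, and `[-1, 1]` for `r = 0`. -/
noncomputable def sgnSet (r : ℝ) : Set ℝ :=
  if r = 0 then Set.Icc (-1) 1 else {Real.sign r}

/-- The state of the closed loop: actions `x`, estimates `y i j` by player `i` of the action of
player `j`, and the observer states `xhat`, `zhat`, all as functions of time. -/
structure Trajectory (N : ℕ) where
  x : ℝ → Fin N → ℝ
  y : ℝ → Fin N → Fin N → ℝ
  xhat : ℝ → Fin N → ℝ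
  zhat : ℝ → Fin N → ℝ

namespace Trajectory

variable {N : ℕ} (S : Trajectory N)

/-- The control input `u_i = -∂f_i/∂x_i (y_i) - ẑ_i`. -/
noncomputable def u (f : Fin N → (Fin N → ℝ) → ℝ) (t : ℝ) (i : Fin N) : ℝ :=
  -partialOwn f i (S.y t i) - S.zhat t i

/-- `ζ_{i1} = x_i - x̂_i`. -/
def zeta1 (t : ℝ) (i : Fin N) : ℝ := S.x t i - S.xhat t i

/-- `ζ_{i2} = z_i - ẑ_i` with `z_i = g_i(x) + d_i(t)`. -/
def zeta2 (g : Fin N → (Fin N → ℝ) → ℝ) (d : Fin N → ℝ → ℝ) (t : ℝ) (i : Fin N) : ℝ :=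
  (g i (S.x t) + d i t) - S.zhat t i

/-- `ξ_i = x_i - x_i^*`. -/
def xi (xs : Fin N → ℝ) (t : ℝ) (i : Fin N) : ℝ := S.x t i - xs i

/-- `η_{ij} = y_{ij} - x_j`. -/
def eta (t : ℝ) (i j : Fin N) : ℝ := S.y t i j - S.x t j

/-- The filtered signal `γ_i = ζ̇_{i1} + c_i ζ_{i1}` of a trajectory on the time interval `J`
(the derivative is one-sided at an endpoint of `J`). -/
noncomputable def gamma (c : Fin N → ℝ) (J : Set ℝ) (t : ℝ) (i : Fin N) : ℝ :=
  derivWithin (fun τ => S.zeta1 τ i) J t + c i * S.zeta1 t i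

/-- The concatenated error vector `(ζ_1, ζ_2, ξ, η, γ)`; its norm is the Euclidean one. -/
noncomputable def error (g : Fin N → (Fin N → ℝ) → ℝ) (d : Fin N → ℝ → ℝ) (xs c : Fin N → ℝ)
    (J : Set ℝ) (t : ℝ) :
    EuclideanSpace ℝ (Fin N ⊕ Fin N ⊕ Fin N ⊕ (Fin N × Fin N) ⊕ Fin N) :=
  WithLp.toLp 2
    (Sum.elim (S.zeta1 t)
      (Sum.elim (S.zeta2 g d t)
        (Sum.elim (S.xi xs t)
          (Sum.elim (fun p => S.eta t p.1 p.2) (S.gamma c J t)))))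

/-- `S` is a (Filippov) solution of the closed loop on the interval `J` (which is
`[t₀, T)` or `[t₀, ∞)`).  The equations of `x`, `y`, `x̂` have continuous right-hand sides along a
solution and so hold at every time.  The equation of `ẑ` has the signum term: `ẑ_i` is locally
absolutely continuous and satisfies the equation almost everywhere, with a value in `[-1, 1]` for
`sgn 0`.  In particular every Carathéodory solution for the convention `sgn 0 = 0` is included. -/
structure IsSolution (f g : Fin N → (Fin N → ℝ) → ℝ) (d : Fin N → ℝ → ℝ)
    (a θbar : Matrix (Fin N) (Fin N) ℝ) (θ : ℝ) (ks c β : Fin N → ℝ)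
    (t₀ : ℝ) (J : Set ℝ) : Prop where
  deriv_x : ∀ t ∈ J, ∀ i,
    HasDerivWithinAt (fun τ => S.x τ i) (S.u f t i + g i (S.x t) + d i t) J t
  deriv_y : ∀ t ∈ J, ∀ i j,
    HasDerivWithinAt (fun τ => S.y τ i j)
      (-(θ * θbar i j) *
        (∑ k, a i k * (S.y t i j - S.y t k j) + a i j * (S.y t i j - S.x t j))) J t
  deriv_xhat : ∀ t ∈ J, ∀ i,
    HasDerivWithinAt (fun τ => S.xhat τ i)
      (S.u f t i + S.zhat t i + (ks i + c i) * (S.x t i - S.xhat t i)) J t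
  ac_zhat : ∀ t ∈ J, ∀ i, AbsolutelyContinuousOnInterval (fun τ => S.zhat τ i) t₀ t
  deriv_zhat : ∀ i, ∀ᵐ t, t ∈ J → ∃ s ∈ sgnSet (S.x t i - S.xhat t i),
    HasDerivWithinAt (fun τ => S.zhat τ i)
      (ks i * c i * (S.x t i - S.xhat t i) + β i * s) J t

end Trajectory

end RISE

/-!
A strongly monotone `C¹` vector field has exactly one zero, and the zeros of the pseudo-gradient are
the Nash equilibria, since each cost is convex in the own action of its player.

The errors are measured relative to the observer state `x̂` instead of the action `x`, so that the
unknown drift `g_i(x) + d_i` drops out of their derivatives. The Lyapunov function is a sum of a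
quadratic form for the Nash seeking part, damped by strong monotonicity of the pseudo-gradient and,
for large `θ`, by the grounded Laplacians of the graph, and of `A` times an observer part built from
`p² / (2β) + |q| - q ḋ / β`, with `q = x - x̂` and `p` its filtered derivative. The derivative
of `|q|` cancels the signum term of `p² / (2β)`, and the perturbations that remain carry a factor
`1 / β`.

The choice of the gains is not circular, because `A`, the radius `B` and the rate `κ` are fixed
first. The local Lipschitz constants on the sublevel set `V ≤ B` then determine in turn `θ`, `c` and
`β` for which `V' ≤ -κ V` almost everywhere on it, and a barrier argument keeps the solution inside.
-/

namespace RISE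

open Set Filter Topology MeasureTheory

section AbsoluteContinuity

variable {a b : ℝ}

theorem absolutelyContinuousOnInterval_comp_lipschitzWith {X Y : Type*} [PseudoMetricSpace X]
    [PseudoMetricSpace Y] {φ : X → Y} {K : NNReal} {u : ℝ → X} (hφ : LipschitzWith K φ)
    (hu : AbsolutelyContinuousOnInterval u a b) :
    AbsolutelyContinuousOnInterval (fun t => φ (u t)) a b := by
  refine squeeze_zero (fun I => Finset.sum_nonneg fun i _ => dist_nonneg) (fun I => ?_)
    (by simpa only [mul_zero] using Tendsto.const_mul (K : ℝ) hu)
  rw [Finset.mul_sum]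
  exact Finset.sum_le_sum fun i _ => hφ.dist_le_mul _ _

theorem absolutelyContinuousOnInterval_abs {u : ℝ → ℝ}
    (hu : AbsolutelyContinuousOnInterval u a b) :
    AbsolutelyContinuousOnInterval (fun t => |u t|) a b :=
  absolutelyContinuousOnInterval_comp_lipschitzWith lipschitzWith_one_norm hu

theorem absolutelyContinuousOnInterval_sum {ι E : Type*} [SeminormedAddCommGroup E]
    (s : Finset ι) {u : ι → ℝ → E}
    (hu : ∀ i ∈ s, AbsolutelyContinuousOnInterval (u i) a b) :
    AbsolutelyContinuousOnInterval (fun t => ∑ i ∈ s, u i t) a b := by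
  classical
  induction s using Finset.induction_on with
  | empty =>
    simpa only [Finset.sum_empty] using
      (LipschitzWith.const (0 : E)).lipschitzOnWith.absolutelyContinuousOnInterval
  | insert i s hi ih =>
    simp only [Finset.sum_insert hi]
    exact (hu i (Finset.mem_insert_self i s)).fun_add
      (ih fun j hj => hu j (Finset.mem_insert_of_mem hj))

theorem absolutelyContinuousOnInterval_of_hasDerivWithinAt {E : Type*} [NormedAddCommGroup E]
    [NormedSpace ℝ E] {u u' : ℝ → E} (hab : a ≤ b)
    (hu : ∀ t ∈ Icc a b, HasDerivWithinAt u (u' t) (Icc a b) t)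
    (hu' : ContinuousOn u' (Icc a b)) : AbsolutelyContinuousOnInterval u a b := by
  obtain ⟨C, hC⟩ := isCompact_Icc.exists_bound_of_continuousOn hu'
  have hlip : LipschitzOnWith C.toNNReal u (Icc a b) :=
    (convex_Icc a b).lipschitzOnWith_of_nnnorm_hasDerivWithin_le hu fun t ht =>
      NNReal.coe_le_coe.1 ((hC t ht).trans (Real.le_coe_toNNReal C))
  rw [← uIcc_of_le hab] at hlip
  exact hlip.absolutelyContinuousOnInterval

theorem le_of_ae_hasDerivAt_nonpos {U : ℝ → ℝ} (hab : a ≤ b)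
    (hU : AbsolutelyContinuousOnInterval U a b)
    (hd : ∀ᵐ t, t ∈ Ioo a b → ∃ D ≤ 0, HasDerivAt U D t) : U b ≤ U a := by
  have hint : ∫ t in a..b, deriv U t ≤ 0 := by
    rw [intervalIntegral.integral_of_le hab, integral_Ioc_eq_integral_Ioo]
    refine integral_nonpos_of_ae ((ae_restrict_iff' measurableSet_Ioo).2 ?_)
    filter_upwards [hd] with t ht hmem
    obtain ⟨D, hD, hUD⟩ := ht hmem
    exact hUD.deriv.trans_le hD
  linarith [hU.integral_deriv_eq_sub]

theorem le_mul_exp_of_ae_hasDerivAt_le {U : ℝ → ℝ} {κ : ℝ} (hab : a ≤ b)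
    (hU : AbsolutelyContinuousOnInterval U a b)
    (hd : ∀ᵐ t, t ∈ Ioo a b → ∃ D ≤ -κ * U t, HasDerivAt U D t) :
    U b ≤ U a * Real.exp (-κ * (b - a)) := by
  have hE : ∀ t, HasDerivAt (fun t => Real.exp (κ * (t - a))) (Real.exp (κ * (t - a)) * κ) t :=
    fun t => by simpa using (((hasDerivAt_id t).sub_const a).const_mul κ).exp
  have hEac : AbsolutelyContinuousOnInterval (fun t => Real.exp (κ * (t - a))) a b :=
    ContDiffOn.absolutelyContinuousOnInterval (by fun_prop)
  have hle : Real.exp (κ * (b - a)) * U b ≤ Real.exp (κ * (a - a)) * U a := by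
    refine le_of_ae_hasDerivAt_nonpos hab (hEac.fun_mul hU) ?_
    filter_upwards [hd] with t ht hmem
    obtain ⟨D, hD, hUD⟩ := ht hmem
    refine ⟨_, ?_, (hE t).mul hUD⟩
    nlinarith [Real.exp_pos (κ * (t - a))]
  calc U b = Real.exp (-κ * (b - a)) * (Real.exp (κ * (b - a)) * U b) := by
        rw [← mul_assoc, ← Real.exp_add]; simp
    _ ≤ Real.exp (-κ * (b - a)) * (Real.exp (κ * (a - a)) * U a) := by gcongr
    _ = U a * Real.exp (-κ * (b - a)) := by simp [mul_comm]

theorem le_mul_exp_of_barrier {U : ℝ → ℝ} {κ B : ℝ} (hab : a ≤ b) (hκ : 0 ≤ κ)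
    (hU : AbsolutelyContinuousOnInterval U a b) (h0 : 0 ≤ U a) (hB : U a < B)
    (hd : ∀ᵐ t, t ∈ Ioo a b → U t ≤ B → ∃ D ≤ -κ * U t, HasDerivAt U D t) :
    U b ≤ U a * Real.exp (-κ * (b - a)) := by
  have decay_of_below : ∀ s ∈ Icc a b, (∀ t ∈ Ioo a s, U t ≤ B) →
      U s ≤ U a * Real.exp (-κ * (s - a)) := fun s hs hle => by
    refine le_mul_exp_of_ae_hasDerivAt_le hs.1
      (hU.mono (by simpa only [uIcc_of_le hab, uIcc_of_le hs.1] using Icc_subset_Icc_right hs.2)) ?_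
    filter_upwards [hd] with t ht hmem
    exact ht ⟨hmem.1, hmem.2.trans_le hs.2⟩ (hle t hmem)
  suffices hbelow : ∀ t ∈ Icc a b, U t < B from
    decay_of_below b ⟨hab, le_rfl⟩ fun t ht => (hbelow t (Ioo_subset_Icc_self ht)).le
  -- At the first time `τ` at which `U` reaches `B`, the decay up to `τ` already gives `U τ < B`.
  by_contra! ⟨t, ht, htB⟩
  have hc : ContinuousOn U (Icc a b) := uIcc_of_le hab ▸ hU.continuousOn
  obtain ⟨τ, ⟨hτ, hBτ⟩, hfirst⟩ := (isCompact_Icc.of_isClosed_subset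
    (hc.preimage_isClosed_of_isClosed isClosed_Icc isClosed_Ici)
    inter_subset_left).exists_isLeast ⟨t, ht, htB⟩
  have hdecay := decay_of_below τ hτ fun t ht => by
    by_contra! hlt
    exact ht.2.not_ge (hfirst ⟨⟨ht.1.le, ht.2.le.trans hτ.2⟩, hlt.le⟩)
  have hexp : Real.exp (-κ * (τ - a)) ≤ 1 := by
    rw [Real.exp_le_one_iff, neg_mul, Left.neg_nonpos_iff]
    exact mul_nonneg hκ (sub_nonneg.2 hτ.1)
  exact (hdecay.trans (mul_le_of_le_one_right h0 hexp)).not_gt (hB.trans_le hBτ)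

end AbsoluteContinuity

section ConvexifiedSign

variable {r s : ℝ}

theorem mem_sgnSet_iff : s ∈ sgnSet r ↔ |s| ≤ 1 ∧ s * r = |r| := by
  rcases lt_trichotomy r 0 with hr | rfl | hr
  · simp only [sgnSet, if_neg hr.ne, Real.sign_of_neg hr, mem_singleton_iff, abs_of_neg hr]
    refine ⟨by rintro rfl; simp, fun h => mul_right_cancel₀ hr.ne (by linarith [h.2])⟩
  · simp [sgnSet, abs_le]
  · simp only [sgnSet, if_neg hr.ne', Real.sign_of_pos hr, mem_singleton_iff, abs_of_pos hr]
    refine ⟨by rintro rfl; simp, fun h => mul_right_cancel₀ hr.ne' (by linarith [h.2])⟩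

theorem sgnSet_of_ne_zero (hr : r ≠ 0) : sgnSet r = {(SignType.sign r : ℝ)} := by
  rcases hr.lt_or_gt with h | h <;> simp [sgnSet, hr, h, Real.sign_of_neg, Real.sign_of_pos]

theorem hasDerivAt_abs_of_mem_sgnSet {q : ℝ → ℝ} {q' t : ℝ} (hq : HasDerivAt q q' t)
    (hd : DifferentiableAt ℝ (fun τ => |q τ|) t) (hs : s ∈ sgnSet (q t)) :
    HasDerivAt (fun τ => |q τ|) (s * q') t := by
  by_cases h0 : q t = 0
  · have hmin : IsLocalMin (fun τ => |q τ|) t := Eventually.of_forall fun τ => by simp [h0]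
    have habs : HasDerivAt (fun τ => |q τ|) 0 t := by
      simpa only [hmin.hasDerivAt_eq_zero hd.hasDerivAt] using hd.hasDerivAt
    have hq0 : HasDerivAt q 0 t := by
      rw [hasDerivAt_iff_isLittleO, ← Asymptotics.isLittleO_norm_left] at habs ⊢
      simpa [h0] using habs
    rwa [hq.unique hq0, mul_zero]
  · rw [sgnSet_of_ne_zero h0, mem_singleton_iff] at hs
    exact hs ▸ (hasDerivAt_abs h0).comp t hq

end ConvexifiedSign

section SupNorm

variable {ι : Type*} [Fintype ι]

theorem sq_norm_le_dotProduct_self (v : ι → ℝ) : ‖v‖ ^ 2 ≤ v ⬝ᵥ v := by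
  have hv : 0 ≤ v ⬝ᵥ v := Finset.sum_nonneg fun i _ => mul_self_nonneg _
  refine (Real.le_sqrt (norm_nonneg _) hv).1 ((pi_norm_le_iff_of_nonneg (Real.sqrt_nonneg _)).2
    fun i => Real.abs_le_sqrt ?_)
  rw [sq]
  exact Finset.single_le_sum (f := fun i => v i * v i) (fun i _ => mul_self_nonneg _)
    (Finset.mem_univ i)

theorem dotProduct_le_norm_mul_sum_abs (u v : ι → ℝ) : u ⬝ᵥ v ≤ ‖u‖ * ∑ i, |v i| := by
  rw [dotProduct, Finset.mul_sum]
  refine Finset.sum_le_sum fun i _ => (le_abs_self _).trans ?_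
  rw [abs_mul]
  gcongr
  exact norm_le_pi_norm u i

theorem sum_abs_le_card_mul {v : ι → ℝ} {r : ℝ} (hv : ∀ i, |v i| ≤ r) :
    ∑ i, |v i| ≤ Fintype.card ι * r := by
  simpa using Finset.sum_le_card_nsmul Finset.univ _ r fun i _ => hv i

end SupNorm

section Consensus

theorem exists_pos_mul_sq_norm_le {E : Type*} [NormedAddCommGroup E] [NormedSpace ℝ E]
    [ProperSpace E] {Q : E → ℝ} (hc : Continuous Q) (hh : ∀ (r : ℝ) v, Q (r • v) = r ^ 2 * Q v)
    (hp : ∀ v ≠ 0, 0 < Q v) : ∃ l > 0, ∀ v, l * ‖v‖ ^ 2 ≤ Q v := by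
  obtain ⟨l, hl, hle⟩ := (isCompact_sphere (0 : E) 1).exists_forall_le' hc.continuousOn
    fun u hu => hp u (ne_zero_of_mem_unit_sphere ⟨u, hu⟩)
  refine ⟨l, hl, fun v => ?_⟩
  rcases eq_or_ne v 0 with rfl | hv
  · simpa using (hh 0 0).ge
  · have hv' : 0 < ‖v‖ := norm_pos_iff.2 hv
    have hunit := hle (‖v‖⁻¹ • v) (by simp [norm_smul, hv'.ne'])
    rwa [hh, inv_pow, inv_mul_eq_div, le_div_iff₀ (by positivity)] at hunit

theorem exists_pos_le_mul_sq_norm {E : Type*} [NormedAddCommGroup E] [NormedSpace ℝ E]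
    [ProperSpace E] {Q : E → ℝ} (hc : Continuous Q) (hh : ∀ (r : ℝ) v, Q (r • v) = r ^ 2 * Q v) :
    ∃ C > 0, ∀ v, Q v ≤ C * ‖v‖ ^ 2 := by
  obtain ⟨C, hC⟩ := (isCompact_sphere (0 : E) 1).exists_bound_of_continuousOn hc.continuousOn
  refine ⟨max C 1, by positivity, fun v => ?_⟩
  rcases eq_or_ne v 0 with rfl | hv
  · simpa using (hh 0 0).le
  · have hv' : 0 < ‖v‖ := norm_pos_iff.2 hv
    have hunit := (Real.le_norm_self _).trans (hC (‖v‖⁻¹ • v) (by simp [norm_smul, hv'.ne']))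
    rw [hh, inv_pow, inv_mul_eq_div, div_le_iff₀ (by positivity)] at hunit
    exact hunit.trans (by gcongr; exact le_max_left C 1)

variable {N : ℕ} {a : Matrix (Fin N) (Fin N) ℝ}

/-- The quadratic form of the Laplacian of `a` grounded at `j`: each `v i` is compared with its
neighbours `v k` and, if `i` is a neighbour of `j`, with the reference value `0` held by `j`. -/
def groundedForm (a : Matrix (Fin N) (Fin N) ℝ) (j : Fin N) (v : Fin N → ℝ) : ℝ :=
  ∑ i, v i * (∑ k, a i k * (v i - v k) + a i j * v i)

theorem groundedForm_smul (j : Fin N) (r : ℝ) (v : Fin N → ℝ) :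
    groundedForm a j (r • v) = r ^ 2 * groundedForm a j v := by
  simp only [groundedForm, Pi.smul_apply, smul_eq_mul, Finset.mul_sum, mul_add]
  refine Finset.sum_congr rfl fun i _ => ?_
  congr 1
  · exact Finset.sum_congr rfl fun k _ => by ring
  · ring

theorem groundedForm_eq (hs : ∀ i j, a i j = a j i) (j : Fin N) (v : Fin N → ℝ) :
    groundedForm a j v
      = (1 / 2) * ∑ i, ∑ k, a i k * (v i - v k) ^ 2 + ∑ i, a i j * v i ^ 2 := by
  have hswap : ∑ i, ∑ k, a i k * (v i * (v i - v k)) = ∑ i, ∑ k, a i k * (v k * (v k - v i)) := by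
    rw [Finset.sum_comm]
    exact Finset.sum_congr rfl fun i _ => Finset.sum_congr rfl fun k _ => by rw [hs]
  have hsq : ∑ i, ∑ k, a i k * (v i - v k) ^ 2
      = ∑ i, ∑ k, a i k * (v i * (v i - v k)) + ∑ i, ∑ k, a i k * (v k * (v k - v i)) := by
    simp only [← Finset.sum_add_distrib]
    exact Finset.sum_congr rfl fun i _ => Finset.sum_congr rfl fun k _ => by ring
  have hform : groundedForm a j v
      = ∑ i, ∑ k, a i k * (v i * (v i - v k)) + ∑ i, a i j * v i ^ 2 := by
    simp only [groundedForm, mul_add, Finset.mul_sum, Finset.sum_add_distrib]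
    congr 1
    · exact Finset.sum_congr rfl fun i _ => Finset.sum_congr rfl fun k _ => by ring
    · exact Finset.sum_congr rfl fun i _ => by ring
  rw [hform, hsq, ← hswap]
  ring

namespace IsUndirectedConnected

theorem pos_of_adj (ha : IsUndirectedConnected a) {i k : Fin N} (h : (commGraph a).Adj i k) :
    0 < a i k :=
  h.2.elim id fun h => ha.symm i k ▸ h

theorem apply_eq_of_forall_adj (ha : IsUndirectedConnected a) {α : Type*} {v : Fin N → α}
    (hv : ∀ i k, (commGraph a).Adj i k → v i = v k) (i k : Fin N) : v i = v k := by
  obtain ⟨w⟩ := ha.connected.preconnected i k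
  induction w with
  | nil => rfl
  | cons h _ ih => exact (hv _ _ h).trans ih

theorem groundedForm_pos (ha : IsUndirectedConnected a) (hN : 2 ≤ N) (j : Fin N)
    {v : Fin N → ℝ} (hv : v ≠ 0) : 0 < groundedForm a j v := by
  have hterm : ∀ i k (r : ℝ), 0 ≤ a i k * r ^ 2 :=
    fun i k r => mul_nonneg (ha.nonneg i k) (sq_nonneg r)
  have hedges : 0 ≤ ∑ i, ∑ k, a i k * (v i - v k) ^ 2 :=
    Finset.sum_nonneg fun i _ => Finset.sum_nonneg fun k _ => hterm i k _
  have hground : 0 ≤ ∑ i, a i j * v i ^ 2 := Finset.sum_nonneg fun i _ => hterm i j _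
  have heq := groundedForm_eq ha.symm j v
  by_contra! hle
  have hedge : ∀ i k, a i k * (v i - v k) ^ 2 = 0 := fun i k => by
    have hrow := (Fintype.sum_eq_zero_iff_of_nonneg
      fun i => Finset.sum_nonneg fun k _ => hterm i k (v i - v k)).1 (by linarith)
    exact congrFun ((Fintype.sum_eq_zero_iff_of_nonneg fun k => hterm i k (v i - v k)).1
      (congrFun hrow i)) k
  have hpin : ∀ i, a i j * v i ^ 2 = 0 := congrFun
    ((Fintype.sum_eq_zero_iff_of_nonneg fun i => hterm i j (v i)).1 (by linarith))
  have hconst := ha.apply_eq_of_forall_adj fun i k h =>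
    sub_eq_zero.1 (sq_eq_zero_iff.1
      ((mul_eq_zero.1 (hedge i k)).resolve_left (ha.pos_of_adj h).ne'))
  have : Nontrivial (Fin N) := Fin.nontrivial_iff_two_le.2 hN
  obtain ⟨i, hi⟩ := ha.connected.preconnected.exists_adj_of_nontrivial j
  have hvi : v i = 0 :=
    sq_eq_zero_iff.1 ((mul_eq_zero.1 (hpin i)).resolve_left (ha.pos_of_adj hi.symm).ne')
  exact hv (funext fun k => (hconst k i).trans hvi)

theorem exists_pos_mul_sq_norm_le_sum_groundedForm (ha : IsUndirectedConnected a) (hN : 2 ≤ N) :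
    ∃ l > 0, ∀ η : Fin N → Fin N → ℝ, l * ‖η‖ ^ 2 ≤ ∑ j, groundedForm a j fun i => η i j := by
  refine exists_pos_mul_sq_norm_le (by unfold groundedForm; fun_prop) (fun r η => ?_)
    fun η hη => ?_
  · simp only [Finset.mul_sum, ← groundedForm_smul]
    rfl
  · have hnonneg : ∀ j v, 0 ≤ groundedForm a j v := fun j v => by
      rcases eq_or_ne v 0 with rfl | hv
      · simp [groundedForm]
      · exact (ha.groundedForm_pos hN j hv).le
    obtain ⟨j, hj⟩ : ∃ j, (fun i => η i j) ≠ 0 := by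
      by_contra! h
      exact hη (funext fun i => funext fun j => congrFun (h j) i)
    exact Finset.sum_pos' (fun j _ => hnonneg j _)
      ⟨j, Finset.mem_univ j, ha.groundedForm_pos hN j hj⟩

end IsUndirectedConnected

end Consensus

section StronglyMonotone

theorem antilipschitzWith_of_hasFDerivAt {E F : Type*} [NormedAddCommGroup E] [NormedSpace ℝ E]
    [NormedAddCommGroup F] [NormedSpace ℝ F] {G : E → F} {G' : E →L[ℝ] F} {x : E} {K : NNReal}
    (hG : HasFDerivAt G G' x) (hK : AntilipschitzWith K G) : AntilipschitzWith K G' := by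
  refine AddMonoidHomClass.antilipschitz_of_bound G' fun v => ?_
  have hslope : Tendsto (fun s : ℝ => K * ‖s⁻¹ • (G (x + s • v) - G x)‖) (𝓝[≠] 0)
      (𝓝 (K * ‖G' v‖)) :=
    ((hG.hasLineDerivAt v).tendsto_slope_zero.norm).const_mul _
  refine ge_of_tendsto hslope ?_
  filter_upwards [self_mem_nhdsWithin] with s hs
  have hs' : 0 < ‖s‖ := norm_pos_iff.2 hs
  have hdist := hK.le_mul_dist (x + s • v) x
  rw [dist_eq_norm, dist_eq_norm, add_sub_cancel_left, norm_smul] at hdist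
  rw [norm_smul, norm_inv, mul_left_comm, inv_mul_eq_div, le_div_iff₀ hs', mul_comm]
  exact hdist

theorem bijective_of_contDiff_of_antilipschitzWith {E : Type*} [NormedAddCommGroup E]
    [NormedSpace ℝ E] [FiniteDimensional ℝ E] {G : E → E} {K : NNReal} (hG : ContDiff ℝ 1 G)
    (hK : AntilipschitzWith K G) : Function.Bijective G := by
  have : CompleteSpace E := FiniteDimensional.complete ℝ E
  have : ProperSpace E := FiniteDimensional.proper ℝ E
  have hopen : IsOpenMap G := isOpenMap_iff_nhds_le.2 fun x => by
    have hstrict := hG.contDiffAt.hasStrictFDerivAt (x := x) one_ne_zero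
    refine (hstrict.map_nhds_eq_of_surj (LinearMap.range_eq_top.2 ?_)).ge
    exact LinearMap.injective_iff_surjective.1
      (antilipschitzWith_of_hasFDerivAt hstrict.hasFDerivAt hK).injective
  have hproper : IsProperMap G := isProperMap_iff_tendsto_cocompact.2
    ⟨hG.continuous, by simpa only [Metric.cobounded_eq_cocompact] using hK.tendsto_cobounded⟩
  have hclopen : IsClopen (range G) := ⟨hproper.isClosed_range, hopen.isOpen_range⟩
  exact ⟨hK.injective, range_eq_univ.1 (hclopen.eq_univ (range_nonempty G))⟩

theorem antilipschitzWith_of_stronglyMonotone {ι : Type*} [Fintype ι] {G : (ι → ℝ) → ι → ℝ} {m : ℝ}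
    (hm : 0 < m) (hmono : ∀ x z, m * ((x - z) ⬝ᵥ (x - z)) ≤ (x - z) ⬝ᵥ (G x - G z)) :
    AntilipschitzWith (Fintype.card ι / m).toNNReal G := by
  refine AntilipschitzWith.of_le_mul_dist fun x z => ?_
  rw [Real.coe_toNNReal _ (by positivity), div_mul_eq_mul_div, le_div_iff₀ hm]
  rcases eq_or_ne x z with rfl | hxz
  · simp
  refine le_of_mul_le_mul_left ?_ (dist_pos.2 hxz)
  simp only [dist_eq_norm]
  calc ‖x - z‖ * (‖x - z‖ * m) = m * ‖x - z‖ ^ 2 := by ring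
    _ ≤ m * ((x - z) ⬝ᵥ (x - z)) := by gcongr; exact sq_norm_le_dotProduct_self _
    _ ≤ (x - z) ⬝ᵥ (G x - G z) := hmono x z
    _ ≤ ‖x - z‖ * ∑ i, |(G x - G z) i| := dotProduct_le_norm_mul_sum_abs _ _
    _ ≤ ‖x - z‖ * (Fintype.card ι * ‖G x - G z‖) := by
        gcongr
        exact sum_abs_le_card_mul fun i => norm_le_pi_norm (G x - G z) i

end StronglyMonotone

section Nash

variable {N : ℕ} {f : Fin N → (Fin N → ℝ) → ℝ}

theorem contDiff_partialOwn {i : Fin N} (hf : ContDiff ℝ 2 (f i)) :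
    ContDiff ℝ 1 (partialOwn f i) :=
  (hf.fderiv_right one_add_one_eq_two.le).clm_apply contDiff_const

theorem hasDerivAt_comp_update {i : Fin N} (hf : Differentiable ℝ (f i)) (x : Fin N → ℝ) (s : ℝ) :
    HasDerivAt (fun s => f i (Function.update x i s))
      (partialOwn f i (Function.update x i s)) s :=
  (hf _).hasFDerivAt.comp_hasDerivAt s (hasDerivAt_update x i s)

theorem IsNash.pseudoGradient_eq_zero (hf : ∀ i, Differentiable ℝ (f i)) {xs : Fin N → ℝ}
    (h : IsNash f xs) : pseudoGradient f xs = 0 := by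
  funext i
  have hmin : IsLocalMin (fun s => f i (Function.update xs i s)) (xs i) :=
    Eventually.of_forall fun s => by simpa using h i s
  simpa [pseudoGradient] using hmin.hasDerivAt_eq_zero (hasDerivAt_comp_update (hf i) xs (xs i))

theorem monotone_partialOwn_update
    (hmono : ∀ x z, 0 ≤ (x - z) ⬝ᵥ (pseudoGradient f x - pseudoGradient f z))
    (x : Fin N → ℝ) (i : Fin N) : Monotone fun s => partialOwn f i (Function.update x i s) := by
  refine monotone_iff_forall_lt.2 fun r s hrs => ?_
  have hdiff : Function.update x i s - Function.update x i r = Pi.single i (s - r) := by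
    rw [← Function.update_sub, sub_self, Pi.single]
  have h := hmono (Function.update x i s) (Function.update x i r)
  rw [hdiff, single_dotProduct] at h
  exact sub_nonneg.1 (nonneg_of_mul_nonneg_right h (sub_pos.2 hrs))

theorem isNash_of_pseudoGradient_eq_zero (hf : ∀ i, Differentiable ℝ (f i))
    (hmono : ∀ x z, 0 ≤ (x - z) ⬝ᵥ (pseudoGradient f x - pseudoGradient f z))
    {xs : Fin N → ℝ} (h : pseudoGradient f xs = 0) : IsNash f xs := by
  intro i s
  have hderiv := hasDerivAt_comp_update (hf i) xs
  have hconv : ConvexOn ℝ univ fun s => f i (Function.update xs i s) := by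
    refine Monotone.convexOn_univ_of_deriv (fun s => (hderiv s).differentiableAt) ?_
    simpa only [funext fun s => (hderiv s).deriv] using monotone_partialOwn_update hmono xs i
  have hcrit : derivWithin (fun s => f i (Function.update xs i s)) (Ioi (xs i)) (xs i) = 0 := by
    rw [(hderiv (xs i)).hasDerivWithinAt.derivWithin (uniqueDiffWithinAt_Ioi _),
      Function.update_eq_self]
    exact congrFun h i
  simpa using hconv.isMinOn_of_rightDeriv_eq_zero (by simp) hcrit (mem_univ s)

theorem existsUnique_isNash (hf : ∀ i, ContDiff ℝ 2 (f i)) {m : ℝ} (hm : 0 < m)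
    (hmono : ∀ x z, m * ((x - z) ⬝ᵥ (x - z)) ≤
      (x - z) ⬝ᵥ (pseudoGradient f x - pseudoGradient f z)) : ∃! xs, IsNash f xs := by
  have hdiff : ∀ i, Differentiable ℝ (f i) := fun i => (hf i).differentiable two_ne_zero
  have hmono₀ : ∀ x z, 0 ≤ (x - z) ⬝ᵥ (pseudoGradient f x - pseudoGradient f z) := fun x z =>
    (mul_nonneg hm.le (Finset.sum_nonneg fun i _ => mul_self_nonneg _)).trans (hmono x z)
  obtain ⟨xs, hxs, huniq⟩ := (bijective_of_contDiff_of_antilipschitzWith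
    (contDiff_pi.2 fun i => contDiff_partialOwn (hf i))
    (antilipschitzWith_of_stronglyMonotone hm hmono)).existsUnique 0
  exact ⟨xs, isNash_of_pseudoGradient_eq_zero hdiff hmono₀ hxs,
    fun z hz => huniq z (hz.pseudoGradient_eq_zero hdiff)⟩

end Nash

section SeekingDynamics

variable {N : ℕ} {a θbar : Matrix (Fin N) (Fin N) ℝ}

/-- The Lyapunov function of the equilibrium seeking dynamics, for the deviation `e = x̂ - x*` and
the estimation errors `η i j = y i j - x̂ j`. The weights of `η` undo the gains `θbar`, so that
the consensus protocol contributes grounded Laplacian forms to the derivative. -/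
noncomputable def seekingLyapunov (θbar : Matrix (Fin N) (Fin N) ℝ) (e : Fin N → ℝ)
    (η : Fin N → Fin N → ℝ) : ℝ :=
  e ⬝ᵥ e / 2 + ∑ i, ∑ j, η i j ^ 2 / (2 * θbar i j)

/-- The time derivative of `seekingLyapunov` when `e` and `η` have the derivatives `e'` and `η'`. -/
noncomputable def seekingRate (θbar : Matrix (Fin N) (Fin N) ℝ) (e e' : Fin N → ℝ)
    (η η' : Fin N → Fin N → ℝ) : ℝ :=
  e ⬝ᵥ e' + ∑ i, ∑ j, η i j * η' i j / θbar i j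

/-- The right-hand side of the consensus protocol, for the estimation errors `η i j = y i j - x̂ j`
and the observer errors `q j = x j - x̂ j`. -/
def consensusField (a θbar : Matrix (Fin N) (Fin N) ℝ) (θ : ℝ) (η : Fin N → Fin N → ℝ)
    (q : Fin N → ℝ) (i j : Fin N) : ℝ :=
  -(θ * θbar i j) * (∑ k, a i k * (η i j - η k j) + a i j * (η i j - q j))

/-- `C` compares `seekingLyapunov` with the squared norm, in both directions. -/
def SeekingComparison (θbar : Matrix (Fin N) (Fin N) ℝ) (C : ℝ) : Prop :=
  ∀ (e : Fin N → ℝ) (η : Fin N → Fin N → ℝ),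
    seekingLyapunov θbar e η ≤ C * ‖(e, η)‖ ^ 2 ∧ ‖(e, η)‖ ^ 2 ≤ C * seekingLyapunov θbar e η

theorem seekingLyapunov_smul (r : ℝ) (e : Fin N → ℝ) (η : Fin N → Fin N → ℝ) :
    seekingLyapunov θbar (r • e) (r • η) = r ^ 2 * seekingLyapunov θbar e η := by
  simp only [seekingLyapunov, dotProduct, Pi.smul_apply, smul_eq_mul, mul_add, Finset.mul_sum,
    Finset.sum_div]
  congr 1
  · exact Finset.sum_congr rfl fun i _ => by ring
  · exact Finset.sum_congr rfl fun i _ => Finset.sum_congr rfl fun j _ => by ring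

theorem seekingLyapunov_pos (hθbar : ∀ i j, 0 < θbar i j) {e : Fin N → ℝ}
    {η : Fin N → Fin N → ℝ} (h : (e, η) ≠ 0) : 0 < seekingLyapunov θbar e η := by
  have hterm : ∀ i j, 0 ≤ η i j ^ 2 / (2 * θbar i j) := fun i j =>
    div_nonneg (sq_nonneg _) (by linarith [hθbar i j])
  have hrow : ∀ i, 0 ≤ ∑ j, η i j ^ 2 / (2 * θbar i j) := fun i =>
    Finset.sum_nonneg fun j _ => hterm i j
  have he := (sq_nonneg ‖e‖).trans (sq_norm_le_dotProduct_self e)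
  have hη := Finset.sum_nonneg fun i (_ : i ∈ Finset.univ) => hrow i
  by_contra! hle
  rw [seekingLyapunov] at hle
  have he0 : e = 0 := dotProduct_self_eq_zero.1 (by linarith)
  have hη0 : η = 0 := funext fun i => funext fun j => by
    have hi := congrFun ((Fintype.sum_eq_zero_iff_of_nonneg (Pi.le_def.2 hrow)).1 (by linarith)) i
    have hij := congrFun ((Fintype.sum_eq_zero_iff_of_nonneg (Pi.le_def.2 (hterm i))).1 hi) j
    simpa [(hθbar i j).ne'] using hij
  exact h (by rw [he0, hη0, Prod.mk_zero_zero])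

theorem exists_seekingComparison (hθbar : ∀ i j, 0 < θbar i j) :
    ∃ C > 0, SeekingComparison θbar C := by
  let V : (Fin N → ℝ) × (Fin N → Fin N → ℝ) → ℝ := fun v => seekingLyapunov θbar v.1 v.2
  have hcont : Continuous V := by unfold V seekingLyapunov dotProduct; fun_prop
  have hhom : ∀ (r : ℝ) v, V (r • v) = r ^ 2 * V v := fun r v => seekingLyapunov_smul r v.1 v.2
  obtain ⟨C, hC, hle⟩ := exists_pos_le_mul_sq_norm hcont hhom
  obtain ⟨l, hl, hge⟩ := exists_pos_mul_sq_norm_le hcont hhom fun _ => seekingLyapunov_pos hθbar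
  refine ⟨max C l⁻¹, by positivity, fun e η => ⟨(hle (e, η)).trans ?_, ?_⟩⟩
  · gcongr
    exact le_max_left _ _
  · have hV : 0 ≤ seekingLyapunov θbar e η :=
      (by positivity : 0 ≤ l * ‖(e, η)‖ ^ 2).trans (hge (e, η))
    calc ‖(e, η)‖ ^ 2 ≤ l⁻¹ * seekingLyapunov θbar e η := (le_inv_mul_iff₀ hl).2 (hge (e, η))
      _ ≤ _ := by gcongr; exact le_max_right _ _

theorem sum_sum_mul_mul_le {A : Matrix (Fin N) (Fin N) ℝ} {b : ℝ} (hA : ∀ i j, |A i j| ≤ b)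
    (hb : 0 ≤ b) (η : Fin N → Fin N → ℝ) (v : Fin N → ℝ) :
    ∑ i, ∑ j, A i j * (η i j * v j) ≤ N * (b * ‖η‖ * ∑ j, |v j|) := by
  have hrow : ∀ i, ∑ j, A i j * (η i j * v j) ≤ b * ‖η‖ * ∑ j, |v j| := fun i => by
    have hnorm : ‖fun j => A i j * η i j‖ ≤ b * ‖η‖ :=
      (pi_norm_le_iff_of_nonneg (by positivity)).2 fun j => by
        rw [norm_mul]
        exact mul_le_mul (hA i j) ((norm_le_pi_norm (η i) j).trans (norm_le_pi_norm η i))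
          (norm_nonneg _) hb
    calc ∑ j, A i j * (η i j * v j) = (fun j => A i j * η i j) ⬝ᵥ v :=
          Finset.sum_congr rfl fun j _ => (mul_assoc _ _ _).symm
      _ ≤ ‖fun j => A i j * η i j‖ * ∑ j, |v j| := dotProduct_le_norm_mul_sum_abs _ _
      _ ≤ _ := by gcongr
  simpa using Finset.sum_le_card_nsmul Finset.univ _ _ fun i _ => hrow i

theorem seekingRate_consensusField (hθbar : ∀ i j, θbar i j ≠ 0) (θ : ℝ) (e r q : Fin N → ℝ)
    (η : Fin N → Fin N → ℝ) :
    seekingRate θbar e r η (fun i j => consensusField a θbar θ η q i j - r j) =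
      e ⬝ᵥ r - θ * ∑ j, groundedForm a j (fun i => η i j)
        + θ * ∑ i, ∑ j, a i j * (η i j * q j) + ∑ i, ∑ j, -(θbar i j)⁻¹ * (η i j * r j) := by
  have hform : ∑ j, groundedForm a j (fun i => η i j)
      = ∑ i, ∑ j, η i j * (∑ k, a i k * (η i j - η k j) + a i j * η i j) := by
    simp only [groundedForm]
    exact Finset.sum_comm
  rw [seekingRate, hform, sub_add_eq_add_sub, add_sub_assoc, add_assoc]
  congr 1
  simp only [Finset.mul_sum, ← Finset.sum_sub_distrib, ← Finset.sum_add_distrib]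
  refine Finset.sum_congr rfl fun i _ => Finset.sum_congr rfl fun j _ => ?_
  have := hθbar i j
  rw [consensusField]
  field_simp
  ring

theorem seekingRate_le {b l m Λ θ Q : ℝ} {e w ρ q : Fin N → ℝ} {η : Fin N → Fin N → ℝ}
    (hθbar : ∀ i j, θbar i j ≠ 0) (ha : ∀ i j, |a i j| ≤ b) (hb : ∀ i j, |(θbar i j)⁻¹| ≤ b)
    (hb0 : 0 ≤ b) (hl : l * ‖η‖ ^ 2 ≤ ∑ j, groundedForm a j fun i => η i j) (hθ : 0 ≤ θ)
    (hew : m * ‖e‖ ^ 2 - N * Λ * (‖e‖ * ‖η‖) ≤ e ⬝ᵥ w) (hw : ∀ i, |w i| ≤ Λ * (‖e‖ + ‖η‖))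
    (hρ : ∑ i, |ρ i| ≤ 2 * Q) (hq : θ * ∑ i, |q i| ≤ Q) :
    seekingRate θbar e (fun i => -w i + ρ i) η
        (fun i j => consensusField a θbar θ η q i j - (-w j + ρ j)) ≤
      -m * ‖e‖ ^ 2 - (θ * l - N ^ 2 * b * Λ) * ‖η‖ ^ 2
        + (N * Λ + N ^ 2 * b * Λ) * (‖e‖ * ‖η‖) + (2 * ‖e‖ + 3 * N * b * ‖η‖) * Q := by
  have hown : e ⬝ᵥ (fun i => -w i + ρ i) ≤
      -(m * ‖e‖ ^ 2 - N * Λ * (‖e‖ * ‖η‖)) + ‖e‖ * (2 * Q) := by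
    have hsplit : e ⬝ᵥ (fun i => -w i + ρ i) = -(e ⬝ᵥ w) + e ⬝ᵥ ρ := by
      rw [← dotProduct_neg, ← dotProduct_add]
      rfl
    have hinput : e ⬝ᵥ ρ ≤ ‖e‖ * (2 * Q) := (dotProduct_le_norm_mul_sum_abs e ρ).trans (by gcongr)
    linarith
  have hconsensus := mul_le_mul_of_nonneg_left hl hθ
  have hleader : θ * ∑ i, ∑ j, a i j * (η i j * q j) ≤ N * (b * ‖η‖ * Q) := by
    calc θ * ∑ i, ∑ j, a i j * (η i j * q j) ≤ θ * (N * (b * ‖η‖ * ∑ j, |q j|)) := by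
          gcongr
          exact sum_sum_mul_mul_le ha hb0 η q
      _ = N * (b * ‖η‖ * (θ * ∑ j, |q j|)) := by ring
      _ ≤ _ := by gcongr
  have hrate : ∑ j, |-w j + ρ j| ≤ N * (Λ * (‖e‖ + ‖η‖)) + 2 * Q := by
    have hsum := (sum_abs_le_card_mul hw).trans_eq (by rw [Fintype.card_fin])
    calc ∑ j, |-w j + ρ j| ≤ ∑ j, (|w j| + |ρ j|) :=
          Finset.sum_le_sum fun j _ => (abs_add_le _ _).trans_eq (by rw [abs_neg])
      _ = ∑ j, |w j| + ∑ j, |ρ j| := Finset.sum_add_distrib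
      _ ≤ _ := by gcongr
  have hcross : ∑ i, ∑ j, -(θbar i j)⁻¹ * (η i j * (-w j + ρ j)) ≤
      N * (b * ‖η‖ * (N * (Λ * (‖e‖ + ‖η‖)) + 2 * Q)) :=
    (sum_sum_mul_mul_le (A := fun i j => -(θbar i j)⁻¹) (fun i j => (abs_neg _).trans_le (hb i j))
      hb0 η _).trans (by gcongr)
  rw [seekingRate_consensusField hθbar]
  linarith

theorem mul_mul_le_add_sq {m : ℝ} (hm : 0 < m) (K x y : ℝ) :
    K * (x * y) ≤ m / 2 * x ^ 2 + K ^ 2 / (2 * m) * y ^ 2 := by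
  have hsquare : m / 2 * x ^ 2 + K ^ 2 / (2 * m) * y ^ 2 - K * (x * y) =
      (m * x - K * y) ^ 2 / (2 * m) := by
    field_simp
    ring
  exact sub_nonneg.1 (hsquare.symm ▸ by positivity)

theorem sq_norm_prodMk_le {E F : Type*} [NormedAddCommGroup E] [NormedAddCommGroup F] (x : E)
    (y : F) : ‖(x, y)‖ ^ 2 ≤ ‖x‖ ^ 2 + ‖y‖ ^ 2 := by
  rw [Prod.norm_mk]
  rcases max_choice ‖x‖ ‖y‖ with h | h <;> rw [h]
  · exact le_add_of_nonneg_right (sq_nonneg _)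
  · exact le_add_of_nonneg_left (sq_nonneg _)

/-- The dissipation inequality of the seeking dynamics with consensus gain `θ`: here `w` stands for
the partial derivatives `∂f_i/∂x_i (y_i)`, estimated by means of a Lipschitz constant `Λ`, and `ρ`
and `q` for the injected observer errors, whose size is measured by `Q`. -/
def SeekingDissipation (a θbar : Matrix (Fin N) (Fin N) ℝ) (θ m Λ C : ℝ) : Prop :=
  ∀ (e w ρ q : Fin N → ℝ) (η : Fin N → Fin N → ℝ) (Q : ℝ),
    m * ‖e‖ ^ 2 - N * Λ * (‖e‖ * ‖η‖) ≤ e ⬝ᵥ w → (∀ i, |w i| ≤ Λ * (‖e‖ + ‖η‖)) →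
    ∑ i, |ρ i| ≤ 2 * Q → θ * ∑ i, |q i| ≤ Q →
    seekingRate θbar e (fun i => -w i + ρ i) η
        (fun i j => consensusField a θbar θ η q i j - (-w j + ρ j)) ≤
      -(m / 2) * ‖(e, η)‖ ^ 2 + C * ‖(e, η)‖ * Q

theorem exists_eventually_seekingDissipation {m : ℝ} (hN : 2 ≤ N) (ha : IsUndirectedConnected a)
    (hθbar : ∀ i j, 0 < θbar i j) (hm : 0 < m) :
    ∃ C > 0, ∀ Λ : ℝ, ∀ᶠ θ in atTop, SeekingDissipation a θbar θ m Λ C := by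
  obtain ⟨l, hl, hform⟩ := ha.exists_pos_mul_sq_norm_le_sum_groundedForm hN
  obtain ⟨b, hb⟩ := Finite.exists_le fun ij : Fin N × Fin N =>
    max |a ij.1 ij.2| |(θbar ij.1 ij.2)⁻¹|
  have hb0 : 0 ≤ b := (le_max_of_le_left (abs_nonneg _)).trans (hb (⟨0, by omega⟩, ⟨0, by omega⟩))
  refine ⟨2 + 3 * N * b, by positivity, fun Λ => ?_⟩
  set K := N * Λ + N ^ 2 * b * Λ
  filter_upwards [eventually_ge_atTop 0,
    (tendsto_id.atTop_mul_const hl).eventually_ge_atTop (K ^ 2 / (2 * m) + N ^ 2 * b * Λ + m / 2)]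
    with θ hθ hθl e w ρ q η Q hew hw hρ hq
  have hrate := seekingRate_le (l := l) (fun i j => (hθbar i j).ne')
    (fun i j => (le_max_left _ _).trans (hb (i, j)))
    (fun i j => (le_max_right _ _).trans (hb (i, j))) hb0 (hform η) hθ hew hw hρ hq
  have hQ : 0 ≤ Q := le_trans (by positivity) hq
  have hyoung := mul_mul_le_add_sq hm K ‖e‖ ‖η‖
  have hdamping := mul_le_mul_of_nonneg_right hθl (sq_nonneg ‖η‖)
  have hnorm := mul_le_mul_of_nonneg_left (sq_norm_prodMk_le e η) (half_pos hm).le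
  have hinput : (2 * ‖e‖ + 3 * N * b * ‖η‖) * Q ≤ (2 + 3 * N * b) * ‖(e, η)‖ * Q := by
    have he := norm_fst_le (e, η)
    have hη := norm_snd_le (e, η)
    have : 2 * ‖e‖ + 3 * N * b * ‖η‖ ≤ 2 * ‖(e, η)‖ + 3 * N * b * ‖(e, η)‖ := by gcongr
    exact mul_le_mul_of_nonneg_right (this.trans_eq (by ring)) hQ
  simp only [id] at hdamping
  linarith

end SeekingDynamics

section Observer

/-- The Lyapunov function of the observer, for the observer error `q`, the filtered signal `p` and
the derivative `d₁` of the disturbance. After division by `β`, the products of `p` with the signum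
term cancel the derivative of `|q|`, and those of `p` with `d₁` the derivative of `q d₁ / β`. -/
noncomputable def observerLyapunov {ι : Type*} [Fintype ι] (β q p d₁ : ι → ℝ) : ℝ :=
  ∑ i, (p i ^ 2 / (2 * β i) + |q i| - q i * d₁ i / β i)

/-- The time derivative of `observerLyapunov` when `q`, `p`, `d₁` have the derivatives `q'`, `p'`,
`d₂`, and `|q|` has the derivative `s * q'`. -/
noncomputable def observerRate {ι : Type*} [Fintype ι] (β s q p d₁ q' p' d₂ : ι → ℝ) : ℝ :=
  ∑ i, (p i * p' i / β i + s i * q' i - (q' i * d₁ i + q i * d₂ i) / β i)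

variable {ι : Type*} [Fintype ι] {β s q p d₁ : ι → ℝ}

theorem abs_mul_div_le_half {x y b : ℝ} (hy : 2 * |y| ≤ b) (hb : 0 < b) :
    |x * y / b| ≤ |x| / 2 := by
  rw [abs_div, abs_mul, abs_of_pos hb, div_le_iff₀ hb]
  linarith [mul_le_mul_of_nonneg_left hy (abs_nonneg x)]

theorem apply_le_observerLyapunov (hβ : ∀ i, 0 < β i) (hd : ∀ i, 2 * |d₁ i| ≤ β i) (i : ι) :
    p i ^ 2 / (2 * β i) + |q i| / 2 ≤ observerLyapunov β q p d₁ := by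
  have hterm : ∀ i, p i ^ 2 / (2 * β i) + |q i| / 2 ≤
      p i ^ 2 / (2 * β i) + |q i| - q i * d₁ i / β i := fun i => by
    linarith [(abs_le.1 (abs_mul_div_le_half (x := q i) (hd i) (hβ i))).2]
  have hnonneg : ∀ i, 0 ≤ p i ^ 2 / (2 * β i) + |q i| - q i * d₁ i / β i := fun i =>
    (by have := hβ i; positivity : 0 ≤ p i ^ 2 / (2 * β i) + |q i| / 2).trans (hterm i)
  exact (hterm i).trans (Finset.single_le_sum (fun i _ => hnonneg i) (Finset.mem_univ i))

theorem observerLyapunov_nonneg (hβ : ∀ i, 0 < β i) (hd : ∀ i, 2 * |d₁ i| ≤ β i) :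
    0 ≤ observerLyapunov β q p d₁ := by
  rcases isEmpty_or_nonempty ι with hι | ⟨⟨i⟩⟩
  · exact (Finset.sum_of_isEmpty _).ge
  · have := hβ i
    exact (by positivity : 0 ≤ p i ^ 2 / (2 * β i) + |q i| / 2).trans
      (apply_le_observerLyapunov hβ hd i)

theorem observerLyapunov_le (hβ : ∀ i, 0 < β i) (hd : ∀ i, 2 * |d₁ i| ≤ β i) :
    observerLyapunov β q p d₁ ≤ ∑ i, p i ^ 2 / (2 * β i) + 3 / 2 * ∑ i, |q i| := by
  rw [Finset.mul_sum, ← Finset.sum_add_distrib]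
  refine Finset.sum_le_sum fun i _ => ?_
  linarith [(abs_le.1 (abs_mul_div_le_half (x := q i) (hd i) (hβ i))).1]

theorem mul_div_le_of_sq_le {p r β B R Q σ ε ε' : ℝ} (hβ : 0 < β) (hp : p ^ 2 / (2 * β) ≤ B)
    (hr : |r| ≤ R * (Q + σ)) (hQ : 0 ≤ Q) (hε : 0 ≤ ε) (hβ₁ : 2 * B * R ^ 2 ≤ ε ^ 2 * β)
    (hβ₂ : R ^ 2 ≤ 2 * ε' * β) :
    p * r / β ≤ ε * Q + p ^ 2 / (2 * β) + ε' * σ ^ 2 := by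
  rw [div_le_iff₀ (by positivity)] at hp
  have hpR : |p| * R ≤ ε * β := le_of_abs_le <| abs_le_of_sq_le_sq (by
    calc (|p| * R) ^ 2 = p ^ 2 * R ^ 2 := by rw [mul_pow, sq_abs]
      _ ≤ B * (2 * β) * R ^ 2 := by gcongr
      _ = β * (2 * B * R ^ 2) := by ring
      _ ≤ β * (ε ^ 2 * β) := by gcongr
      _ = (ε * β) ^ 2 := by ring) (by positivity)
  have hyoung : |p| * (R * σ) ≤ p ^ 2 / 2 + ε' * β * σ ^ 2 := by
    rw [← sq_abs p]
    nlinarith [sq_nonneg (|p| - R * σ), mul_le_mul_of_nonneg_right hβ₂ (sq_nonneg σ)]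
  rw [div_le_iff₀ hβ]
  calc p * r ≤ |p| * |r| := (le_abs_self _).trans_eq (abs_mul p r)
    _ ≤ |p| * (R * (Q + σ)) := by gcongr
    _ = |p| * R * Q + |p| * (R * σ) := by ring
    _ ≤ ε * β * Q + (p ^ 2 / 2 + ε' * β * σ ^ 2) := by gcongr
    _ = (ε * Q + p ^ 2 / (2 * β) + ε' * σ ^ 2) * β := by field_simp; ring

theorem observerRate_term_eq {p q h r d₁ d₂ s k c β : ℝ} (hβ : β ≠ 0) (hs : s * q = |q|) :
    p * (-k * p + r + d₁ - β * s) / β + s * (p + h - c * q) -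
        ((p + h - c * q) * d₁ + q * d₂) / β =
      -k * p ^ 2 / β + p * r / β + s * h - c * |q| - (h * d₁ - c * q * d₁ + q * d₂) / β := by
  rw [← hs]
  field_simp
  ring

theorem observerRate_term_le {p q h r d₁ d₂ s k c β B M R Q σ δ ε ε' : ℝ} (hβ : 0 < β)
    (hs : s ∈ sgnSet q) (hk : 1 ≤ k) (hc : 1 ≤ c) (hcq : c * |q| ≤ Q) (hh : |h| ≤ δ * Q)
    (hr : |r| ≤ R * (Q + σ)) (hp : p ^ 2 / (2 * β) ≤ B) (hd₁ : |d₁| ≤ M) (hd₂ : |d₂| ≤ M)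
    (hε : 0 ≤ ε) (hβ₁ : 2 * B * R ^ 2 ≤ ε ^ 2 * β) (hβ₂ : R ^ 2 ≤ 2 * ε' * β)
    (hβ₃ : (δ + 2) * M ≤ ε * β) :
    p * (-k * p + r + d₁ - β * s) / β + s * (p + h - c * q) -
        ((p + h - c * q) * d₁ + q * d₂) / β ≤
      -(p ^ 2 / (2 * β)) - c * |q| + (δ + 2 * ε) * Q + ε' * σ ^ 2 := by
  obtain ⟨hs₁, hsq⟩ := mem_sgnSet_iff.1 hs
  have hqQ : |q| ≤ Q := (le_mul_of_one_le_left (abs_nonneg q) hc).trans hcq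
  have hQ : 0 ≤ Q := (abs_nonneg q).trans hqQ
  have hincrement : s * h ≤ δ * Q :=
    calc s * h ≤ |s| * |h| := (le_abs_self _).trans_eq (abs_mul s h)
      _ ≤ 1 * (δ * Q) := by gcongr
      _ = δ * Q := one_mul _
  have hdisturbance : -(h * d₁ - c * q * d₁ + q * d₂) / β ≤ ε * Q := by
    rw [div_le_iff₀ hβ]
    have h₁ : |h * d₁| ≤ δ * Q * M :=
      (abs_mul h d₁).trans_le (mul_le_mul hh hd₁ (abs_nonneg _) ((abs_nonneg _).trans hh))
    have h₂ : |c * q * d₁| ≤ Q * M := by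
      rw [abs_mul, abs_mul, abs_of_nonneg (zero_le_one.trans hc)]
      exact mul_le_mul hcq hd₁ (abs_nonneg _) hQ
    have h₃ : |q * d₂| ≤ Q * M :=
      (abs_mul q d₂).trans_le (mul_le_mul hqQ hd₂ (abs_nonneg _) hQ)
    linarith [neg_le_abs (h * d₁), le_abs_self (c * q * d₁), neg_le_abs (q * d₂),
      mul_le_mul_of_nonneg_right hβ₃ hQ]
  have hremainder := mul_div_le_of_sq_le hβ hp hr hQ hε hβ₁ hβ₂
  have hdamping : -k * p ^ 2 / β + p ^ 2 / (2 * β) ≤ -(p ^ 2 / (2 * β)) := by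
    have hk' : p ^ 2 / β ≤ k * (p ^ 2 / β) := le_mul_of_one_le_left (by positivity) hk
    have h₁ : -k * p ^ 2 / β = -(k * (p ^ 2 / β)) := by ring
    have h₂ : p ^ 2 / (2 * β) = p ^ 2 / β / 2 := by ring
    rw [h₁, h₂]
    linarith
  rw [observerRate_term_eq hβ.ne' hsq, ← add_sub_cancel_right (-k * p ^ 2 / β) (p ^ 2 / (2 * β)),
    sub_eq_add_neg _ (_ / β), ← neg_div]
  linarith

/-- The dissipation inequality of the observer with signum gains `β`, at all points with
`p² / (2β) ≤ B`: here `h` and `r` are the perturbations of the dynamics of `q` and `p`, bounded in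
terms of `∑ i, c i * |q i|` and of the size `σ` of the seeking errors, and `M` bounds the first two
derivatives of the disturbances. -/
def ObserverDissipation (β : ι → ℝ) (M B R μ : ℝ) : Prop :=
  ∀ (ks c s q p h r d₁ d₂ : ι → ℝ) (σ : ℝ), (∀ i, 1 ≤ ks i) → (∀ i, 1 ≤ c i) →
    (∀ i, s i ∈ sgnSet (q i)) → (∀ i, |h i| ≤ (∑ j, c j * |q j|) / (4 * Fintype.card ι)) →
    (∀ i, |r i| ≤ R * (∑ j, c j * |q j| + σ)) → (∀ i, p i ^ 2 / (2 * β i) ≤ B) →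
    (∀ i, |d₁ i| ≤ M) → (∀ i, |d₂ i| ≤ M) →
    observerRate β s q p d₁ (fun i => p i + h i - c i * q i)
        (fun i => -ks i * p i + r i + d₁ i - β i * s i) d₂ ≤
      -∑ i, p i ^ 2 / (2 * β i) - (∑ i, c i * |q i|) / 2 + μ * σ ^ 2

theorem eventually_observerDissipation [Nonempty ι] {μ : ℝ} (hμ : 0 < μ) (M B R : ℝ) :
    ∀ᶠ b in atTop, ∀ β : ι → ℝ, (∀ i, b ≤ β i) → ObserverDissipation β M B R μ := by
  set n := (Fintype.card ι : ℝ)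
  have hn : 0 < n := Nat.cast_pos.2 Fintype.card_pos
  have hlarge : ∀ {k : ℝ} (y : ℝ), 0 < k → ∀ᶠ b in atTop, ∀ b' ≥ b, y ≤ k * b' := fun y hk =>
    eventually_forall_ge_atTop.2 ((tendsto_id.const_mul_atTop hk).eventually_ge_atTop y)
  filter_upwards [eventually_gt_atTop 0,
    hlarge (k := (1 / (8 * n)) ^ 2) (2 * B * R ^ 2) (by positivity),
    hlarge (k := 2 * (μ / n)) (R ^ 2) (by positivity),
    hlarge (k := 1 / (8 * n)) ((1 / (4 * n) + 2) * M) (by positivity)] with b hb hβ₁ hβ₂ hβ₃ β hβ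
    ks c s q p h r d₁ d₂ σ hks hc hs hh hr hp hd₁ hd₂
  set Q := ∑ i, c i * |q i|
  have hcq : ∀ i, c i * |q i| ≤ Q := fun i => Finset.single_le_sum
    (f := fun i => c i * |q i|) (fun i _ => mul_nonneg (zero_le_one.trans (hc i)) (abs_nonneg _))
    (Finset.mem_univ i)
  have hterm := fun i => observerRate_term_le (hb.trans_le (hβ i)) (hs i) (hks i) (hc i) (hcq i)
    ((hh i).trans_eq (by ring : Q / (4 * n) = 1 / (4 * n) * Q)) (hr i) (hp i) (hd₁ i) (hd₂ i)
    (by positivity) (hβ₁ _ (hβ i)) (hβ₂ _ (hβ i)) (hβ₃ _ (hβ i))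
  refine (Finset.sum_le_sum fun i _ => hterm i).trans_eq ?_
  simp only [Finset.sum_add_distrib, Finset.sum_sub_distrib, Finset.sum_neg_distrib,
    Finset.sum_const, Finset.card_univ, nsmul_eq_mul]
  change -_ - Q + n * _ + n * _ = _
  field_simp
  ring

end Observer

section Derivatives

variable {N : ℕ} {θbar : Matrix (Fin N) (Fin N) ℝ} {e : ℝ → Fin N → ℝ}
  {η : ℝ → Fin N → Fin N → ℝ}

theorem hasDerivAt_seekingLyapunov {e' : Fin N → ℝ} {η' : Fin N → Fin N → ℝ} {t : ℝ}
    (he : ∀ i, HasDerivAt (fun τ => e τ i) (e' i) t)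
    (hη : ∀ i j, HasDerivAt (fun τ => η τ i j) (η' i j) t) :
    HasDerivAt (fun τ => seekingLyapunov θbar (e τ) (η τ))
      (seekingRate θbar (e t) e' (η t) η') t := by
  unfold seekingLyapunov seekingRate dotProduct
  refine (((HasDerivAt.fun_sum fun i _ => (he i).mul (he i)).div_const 2).add
    (HasDerivAt.fun_sum fun i _ => HasDerivAt.fun_sum fun j _ =>
      ((hη i j).pow 2).div_const (2 * θbar i j))).congr_deriv ?_
  simp only [Finset.sum_div]
  congr 1
  · exact Finset.sum_congr rfl fun i _ => by ring
  · exact Finset.sum_congr rfl fun i _ => Finset.sum_congr rfl fun j _ => by ring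

theorem hasDerivAt_observerLyapunov {ι : Type*} [Fintype ι] {q p d₁ : ℝ → ι → ℝ}
    {β s q' p' d₂ : ι → ℝ} {t : ℝ} (hq : ∀ i, HasDerivAt (fun τ => q τ i) (q' i) t)
    (habs : ∀ i, HasDerivAt (fun τ => |q τ i|) (s i * q' i) t)
    (hp : ∀ i, HasDerivAt (fun τ => p τ i) (p' i) t)
    (hd : ∀ i, HasDerivAt (fun τ => d₁ τ i) (d₂ i) t) :
    HasDerivAt (fun τ => observerLyapunov β (q τ) (p τ) (d₁ τ))
      (observerRate β s (q t) (p t) (d₁ t) q' p' d₂) t := by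
  unfold observerLyapunov observerRate
  refine (HasDerivAt.fun_sum fun i _ => ((((hp i).pow 2).div_const (2 * β i)).add (habs i)).sub
    (((hq i).mul (hd i)).div_const (β i))).congr_deriv ?_
  exact Finset.sum_congr rfl fun i _ => by ring

theorem absolutelyContinuousOnInterval_seekingLyapunov {t₀ t₁ : ℝ}
    (he : ∀ i, AbsolutelyContinuousOnInterval (fun τ => e τ i) t₀ t₁)
    (hη : ∀ i j, AbsolutelyContinuousOnInterval (fun τ => η τ i j) t₀ t₁) :
    AbsolutelyContinuousOnInterval (fun τ => seekingLyapunov θbar (e τ) (η τ)) t₀ t₁ := by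
  simp only [seekingLyapunov, dotProduct, div_eq_inv_mul, sq]
  exact ((absolutelyContinuousOnInterval_sum _ fun i _ =>
    (he i).fun_mul (he i)).const_mul _).fun_add
      (absolutelyContinuousOnInterval_sum _ fun i _ => absolutelyContinuousOnInterval_sum _
        fun j _ => ((hη i j).fun_mul (hη i j)).const_mul _)

theorem absolutelyContinuousOnInterval_observerLyapunov {ι : Type*} [Fintype ι]
    {q p d₁ : ℝ → ι → ℝ} {β : ι → ℝ} {t₀ t₁ : ℝ}
    (hq : ∀ i, AbsolutelyContinuousOnInterval (fun τ => q τ i) t₀ t₁)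
    (hp : ∀ i, AbsolutelyContinuousOnInterval (fun τ => p τ i) t₀ t₁)
    (hd : ∀ i, AbsolutelyContinuousOnInterval (fun τ => d₁ τ i) t₀ t₁) :
    AbsolutelyContinuousOnInterval (fun τ => observerLyapunov β (q τ) (p τ) (d₁ τ)) t₀ t₁ := by
  simp only [observerLyapunov, div_eq_inv_mul, sq]
  exact absolutelyContinuousOnInterval_sum _ fun i _ =>
    ((((hp i).fun_mul (hp i)).const_mul _).fun_add
      (absolutelyContinuousOnInterval_abs (hq i))).fun_sub (((hq i).fun_mul (hd i)).const_mul _)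

variable {d : ℝ → ℝ} {t₀ t : ℝ}

theorem hasDerivAt_derivWithin_Ici (hd : ContDiffOn ℝ 2 d (Ici t₀)) (ht : t₀ < t) :
    HasDerivAt (derivWithin d (Ici t₀)) (iteratedDerivWithin 2 d (Ici t₀) t) t := by
  have hd' : ContDiffOn ℝ 1 (derivWithin d (Ici t₀)) (Ici t₀) :=
    hd.derivWithin (uniqueDiffOn_Ici t₀) (by norm_num)
  have heq : iteratedDerivWithin 2 d (Ici t₀) t =
      derivWithin (derivWithin d (Ici t₀)) (Ici t₀) t := by
    rw [iteratedDerivWithin_succ]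
    congr 1
    exact funext fun τ => congrFun iteratedDerivWithin_one τ
  exact heq ▸ (hd'.differentiableOn one_ne_zero t ht.le).hasDerivWithinAt.hasDerivAt
    (Ici_mem_nhds ht)

end Derivatives

namespace Trajectory

variable {N : ℕ} (S : Trajectory N)

/-- The deviation of the observer state from the equilibrium; unlike `ξ`, its derivative does not
contain the unknown drift `g_i(x) + d_i`. -/
def errHat (xs : Fin N → ℝ) (t : ℝ) (i : Fin N) : ℝ := S.xhat t i - xs i

/-- The estimation error relative to the observer state, which replaces `η` for the same reason. -/
def etaHat (t : ℝ) (i j : Fin N) : ℝ := S.y t i j - S.xhat t j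

/-- The filtered signal `γ_i` with `g_i(x)` replaced by `g_i(x̂)`. -/
def pHat (g : Fin N → (Fin N → ℝ) → ℝ) (d : Fin N → ℝ → ℝ) (ks : Fin N → ℝ) (t : ℝ)
    (i : Fin N) : ℝ :=
  g i (S.xhat t) + d i t - S.zhat t i - ks i * S.zeta1 t i

/-- The increment of the drift between the observer state and the actions. -/
def gInc (g : Fin N → (Fin N → ℝ) → ℝ) (t : ℝ) (i : Fin N) : ℝ := g i (S.x t) - g i (S.xhat t)

/-- The derivative of the observer state along a solution. -/
noncomputable def xhatRate (f : Fin N → (Fin N → ℝ) → ℝ) (ks c : Fin N → ℝ) (t : ℝ)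
    (i : Fin N) : ℝ :=
  -partialOwn f i (S.y t i) + (ks i + c i) * S.zeta1 t i

/-- The part of the derivative of `pHat` that is dominated by the error, with locally uniform
constants. -/
noncomputable def pRemainder (f g : Fin N → (Fin N → ℝ) → ℝ) (ks c : Fin N → ℝ) (t : ℝ)
    (i : Fin N) : ℝ :=
  fderiv ℝ (g i) (S.xhat t) (S.xhatRate f ks c t) - ks i * S.gInc g t i

/-- The Lyapunov function of the closed loop, with weight `A` on the observer. -/
noncomputable def lyapunov (g : Fin N → (Fin N → ℝ) → ℝ) (d : Fin N → ℝ → ℝ)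
    (θbar : Matrix (Fin N) (Fin N) ℝ) (xs ks β : Fin N → ℝ) (A t₀ t : ℝ) : ℝ :=
  seekingLyapunov θbar (S.errHat xs t) (S.etaHat t) +
    A * observerLyapunov β (S.zeta1 t) (S.pHat g d ks t)
      (fun i => derivWithin (d i) (Ici t₀) t)

/-- The derivative of `lyapunov` along a solution, for a selection `s` of the signum of `ζ₁`. -/
noncomputable def lyapunovRate (f g : Fin N → (Fin N → ℝ) → ℝ) (d : Fin N → ℝ → ℝ)
    (a θbar : Matrix (Fin N) (Fin N) ℝ) (θ : ℝ) (xs ks c β : Fin N → ℝ) (A t₀ t : ℝ)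
    (s : Fin N → ℝ) : ℝ :=
  seekingRate θbar (S.errHat xs t) (S.xhatRate f ks c t) (S.etaHat t)
      (fun i j => consensusField a θbar θ (S.etaHat t) (S.zeta1 t) i j - S.xhatRate f ks c t j) +
    A * observerRate β s (S.zeta1 t) (S.pHat g d ks t) (fun i => derivWithin (d i) (Ici t₀) t)
      (fun i => S.pHat g d ks t i + S.gInc g t i - c i * S.zeta1 t i)
      (fun i => -ks i * S.pHat g d ks t i + S.pRemainder f g ks c t i +
        derivWithin (d i) (Ici t₀) t - β i * s i)
      (fun i => iteratedDerivWithin 2 (d i) (Ici t₀) t)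

namespace IsSolution

variable {S} {f g : Fin N → (Fin N → ℝ) → ℝ} {d : Fin N → ℝ → ℝ}
  {a θbar : Matrix (Fin N) (Fin N) ℝ} {θ t₀ : ℝ} {ks c β : Fin N → ℝ} {J : Set ℝ}

theorem mono (hS : S.IsSolution f g d a θbar θ ks c β t₀ J) {I : Set ℝ} (hI : I ⊆ J) :
    S.IsSolution f g d a θbar θ ks c β t₀ I where
  deriv_x t ht i := (hS.deriv_x t (hI ht) i).mono hI
  deriv_y t ht i j := (hS.deriv_y t (hI ht) i j).mono hI
  deriv_xhat t ht i := (hS.deriv_xhat t (hI ht) i).mono hI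
  ac_zhat t ht := hS.ac_zhat t (hI ht)
  deriv_zhat i := by
    filter_upwards [hS.deriv_zhat i] with t ht hmem
    obtain ⟨s, hs, hz⟩ := ht (hI hmem)
    exact ⟨s, hs, hz.mono hI⟩

section

variable (hS : S.IsSolution f g d a θbar θ ks c β t₀ J) {t : ℝ} (ht : t ∈ J)
include hS ht

theorem hasDerivWithinAt_xhat (i : Fin N) :
    HasDerivWithinAt (fun τ => S.xhat τ i) (S.xhatRate f ks c t i) J t := by
  refine (hS.deriv_xhat t ht i).congr_deriv ?_
  simp only [u, xhatRate, zeta1]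
  ring

theorem hasDerivWithinAt_zeta1 (i : Fin N) : HasDerivWithinAt (fun τ => S.zeta1 τ i)
    (S.pHat g d ks t i + S.gInc g t i - c i * S.zeta1 t i) J t := by
  refine ((hS.deriv_x t ht i).sub (hS.deriv_xhat t ht i)).congr_deriv ?_
  simp only [u, pHat, gInc, zeta1]
  ring

theorem hasDerivWithinAt_etaHat (i j : Fin N) : HasDerivWithinAt (fun τ => S.etaHat τ i j)
    (consensusField a θbar θ (S.etaHat t) (S.zeta1 t) i j - S.xhatRate f ks c t j) J t := by
  refine ((hS.deriv_y t ht i j).sub (hS.hasDerivWithinAt_xhat ht j)).congr_deriv ?_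
  simp only [consensusField, etaHat, zeta1, sub_sub_sub_cancel_right]

theorem hasDerivWithinAt_comp_xhat {F : (Fin N → ℝ) → ℝ} (hF : Differentiable ℝ F) :
    HasDerivWithinAt (fun τ => F (S.xhat τ)) (fderiv ℝ F (S.xhat t) (S.xhatRate f ks c t)) J t :=
  (hF (S.xhat t)).hasFDerivAt.comp_hasDerivWithinAt t
    (hasDerivWithinAt_pi.2 fun j => hS.hasDerivWithinAt_xhat ht j)

theorem gamma_eq (hJ : UniqueDiffOn ℝ J) (i : Fin N) :
    S.gamma c J t i = S.pHat g d ks t i + S.gInc g t i := by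
  rw [gamma, (hS.hasDerivWithinAt_zeta1 ht i).derivWithin (hJ t ht)]
  ring

end

section Continuity

theorem continuousOn_x (hS : S.IsSolution f g d a θbar θ ks c β t₀ J) : ContinuousOn S.x J :=
  continuousOn_pi.2 fun i t ht => (hS.deriv_x t ht i).continuousWithinAt

theorem continuousOn_y (hS : S.IsSolution f g d a θbar θ ks c β t₀ J) : ContinuousOn S.y J :=
  continuousOn_pi.2 fun i => continuousOn_pi.2 fun j t ht =>
    (hS.deriv_y t ht i j).continuousWithinAt

theorem continuousOn_xhat (hS : S.IsSolution f g d a θbar θ ks c β t₀ J) :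
    ContinuousOn S.xhat J :=
  continuousOn_pi.2 fun i t ht => (hS.deriv_xhat t ht i).continuousWithinAt

theorem continuousOn_zeta1 (hS : S.IsSolution f g d a θbar θ ks c β t₀ J) :
    ContinuousOn S.zeta1 J :=
  hS.continuousOn_x.sub hS.continuousOn_xhat

theorem continuousOn_xhatRate (hS : S.IsSolution f g d a θbar θ ks c β t₀ J)
    (hf : ∀ i, ContDiff ℝ 2 (f i)) : ContinuousOn (S.xhatRate f ks c) J :=
  continuousOn_pi.2 fun i => ((contDiff_partialOwn (hf i)).continuous.comp_continuousOn
    (continuousOn_pi.1 hS.continuousOn_y i)).neg.add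
      ((continuousOn_pi.1 hS.continuousOn_zeta1 i).const_mul _)

end Continuity

end IsSolution
end Trajectory

namespace Trajectory
namespace IsSolution

variable {N : ℕ} {S : Trajectory N} {f g : Fin N → (Fin N → ℝ) → ℝ} {d : Fin N → ℝ → ℝ}
  {a θbar : Matrix (Fin N) (Fin N) ℝ} {θ t₀ t₁ : ℝ} {ks c β : Fin N → ℝ}

section AbsoluteContinuity

variable (hS : S.IsSolution f g d a θbar θ ks c β t₀ (Icc t₀ t₁)) (ht : t₀ ≤ t₁)
include hS ht

theorem continuousOn_pHat (hg : ∀ i, ContDiff ℝ 1 (g i))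
    (hd : ∀ i, ContDiffOn ℝ 2 (d i) (Ici t₀)) : ContinuousOn (S.pHat g d ks) (Icc t₀ t₁) :=
  continuousOn_pi.2 fun i => ((((hg i).continuous.comp_continuousOn hS.continuousOn_xhat).add
    ((hd i).continuousOn.mono Icc_subset_Ici_self)).sub
      (uIcc_of_le ht ▸ (hS.ac_zhat t₁ (right_mem_Icc.2 ht) i).continuousOn)).sub
        ((continuousOn_pi.1 hS.continuousOn_zeta1 i).const_mul _)

theorem absolutelyContinuousOnInterval_xhat (hf : ∀ i, ContDiff ℝ 2 (f i)) (i : Fin N) :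
    AbsolutelyContinuousOnInterval (fun τ => S.xhat τ i) t₀ t₁ :=
  absolutelyContinuousOnInterval_of_hasDerivWithinAt ht
    (fun _ hτ => hS.hasDerivWithinAt_xhat hτ i)
    (continuousOn_pi.1 (hS.continuousOn_xhatRate hf) i)

theorem absolutelyContinuousOnInterval_comp_xhat (hf : ∀ i, ContDiff ℝ 2 (f i))
    {F : (Fin N → ℝ) → ℝ} (hF : ContDiff ℝ 1 F) :
    AbsolutelyContinuousOnInterval (fun τ => F (S.xhat τ)) t₀ t₁ :=
  absolutelyContinuousOnInterval_of_hasDerivWithinAt ht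
    (fun _ hτ => hS.hasDerivWithinAt_comp_xhat hτ (hF.differentiable one_ne_zero))
    (((hF.continuous_fderiv one_ne_zero).comp_continuousOn hS.continuousOn_xhat).clm_apply
      (hS.continuousOn_xhatRate hf))

theorem absolutelyContinuousOnInterval_zeta1 (hg : ∀ i, ContDiff ℝ 1 (g i))
    (hd : ∀ i, ContDiffOn ℝ 2 (d i) (Ici t₀)) (i : Fin N) :
    AbsolutelyContinuousOnInterval (fun τ => S.zeta1 τ i) t₀ t₁ :=
  absolutelyContinuousOnInterval_of_hasDerivWithinAt ht
    (fun _ hτ => hS.hasDerivWithinAt_zeta1 hτ i)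
    (((continuousOn_pi.1 (hS.continuousOn_pHat ht hg hd) i).add
      (((hg i).continuous.comp_continuousOn hS.continuousOn_x).sub
        ((hg i).continuous.comp_continuousOn hS.continuousOn_xhat))).sub
          ((continuousOn_pi.1 hS.continuousOn_zeta1 i).const_mul _))

theorem absolutelyContinuousOnInterval_etaHat (hf : ∀ i, ContDiff ℝ 2 (f i)) (i j : Fin N) :
    AbsolutelyContinuousOnInterval (fun τ => S.etaHat τ i j) t₀ t₁ := by
  have hy := continuousOn_pi.1 (continuousOn_pi.1 hS.continuousOn_y i) j
  have hcolumn := fun k => continuousOn_pi.1 (continuousOn_pi.1 hS.continuousOn_y k) j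
  have hxhat := continuousOn_pi.1 hS.continuousOn_xhat j
  refine absolutelyContinuousOnInterval_of_hasDerivWithinAt ht
    (fun _ hτ => hS.hasDerivWithinAt_etaHat hτ i j) (ContinuousOn.sub ?_
      (continuousOn_pi.1 (hS.continuousOn_xhatRate hf) j))
  exact ((continuousOn_finsetSum _ fun k _ =>
    ((hy.sub hxhat).sub ((hcolumn k).sub hxhat)).const_mul _).add
      (((hy.sub hxhat).sub (continuousOn_pi.1 hS.continuousOn_zeta1 j)).const_mul _)).const_mul _

theorem absolutelyContinuousOnInterval_pHat (hf : ∀ i, ContDiff ℝ 2 (f i))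
    (hg : ∀ i, ContDiff ℝ 1 (g i)) (hd : ∀ i, ContDiffOn ℝ 2 (d i) (Ici t₀)) (i : Fin N) :
    AbsolutelyContinuousOnInterval (fun τ => S.pHat g d ks τ i) t₀ t₁ :=
  have hd' : AbsolutelyContinuousOnInterval (d i) t₀ t₁ :=
    (((hd i).of_le one_le_two).mono
      (uIcc_of_le ht ▸ Icc_subset_Ici_self)).absolutelyContinuousOnInterval
  (((hS.absolutelyContinuousOnInterval_comp_xhat ht hf (hg i)).fun_add hd').fun_sub
    (hS.ac_zhat t₁ (right_mem_Icc.2 ht) i)).fun_sub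
      ((hS.absolutelyContinuousOnInterval_zeta1 ht hg hd i).const_mul _)

theorem absolutelyContinuousOnInterval_lyapunov (hf : ∀ i, ContDiff ℝ 2 (f i))
    (hg : ∀ i, ContDiff ℝ 1 (g i)) (hd : ∀ i, ContDiffOn ℝ 2 (d i) (Ici t₀)) (xs : Fin N → ℝ)
    (A : ℝ) : AbsolutelyContinuousOnInterval (S.lyapunov g d θbar xs ks β A t₀) t₀ t₁ := by
  have hd' : ∀ i, AbsolutelyContinuousOnInterval (derivWithin (d i) (Ici t₀)) t₀ t₁ := fun i =>
    (((hd i).derivWithin (uniqueDiffOn_Ici t₀) (by norm_num)).mono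
      (uIcc_of_le ht ▸ Icc_subset_Ici_self)).absolutelyContinuousOnInterval
  have hconst : ∀ r : ℝ, AbsolutelyContinuousOnInterval (fun _ => r) t₀ t₁ := fun r =>
    (LipschitzWith.const r).lipschitzOnWith.absolutelyContinuousOnInterval
  exact (absolutelyContinuousOnInterval_seekingLyapunov
    (fun i => (hS.absolutelyContinuousOnInterval_xhat ht hf i).fun_sub (hconst (xs i)))
    (hS.absolutelyContinuousOnInterval_etaHat ht hf)).fun_add
      ((absolutelyContinuousOnInterval_observerLyapunov
        (hS.absolutelyContinuousOnInterval_zeta1 ht hg hd)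
        (hS.absolutelyContinuousOnInterval_pHat ht hf hg hd) hd').const_mul A)

end AbsoluteContinuity

theorem hasDerivAt_pHat {J : Set ℝ} (hS : S.IsSolution f g d a θbar θ ks c β t₀ J)
    (hg : ∀ i, ContDiff ℝ 1 (g i)) (hd : ∀ i, ContDiffOn ℝ 2 (d i) (Ici t₀)) {t : ℝ}
    (ht : t₀ < t) (hJ : J ∈ 𝓝 t) {i : Fin N} {s : ℝ}
    (hz : HasDerivWithinAt (fun τ => S.zhat τ i)
      (ks i * c i * (S.x t i - S.xhat t i) + β i * s) J t) :
    HasDerivAt (fun τ => S.pHat g d ks τ i)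
      (-ks i * S.pHat g d ks t i + S.pRemainder f g ks c t i +
        derivWithin (d i) (Ici t₀) t - β i * s) t := by
  have hmem := mem_of_mem_nhds hJ
  have hg' := (hS.hasDerivWithinAt_comp_xhat hmem ((hg i).differentiable one_ne_zero)).hasDerivAt hJ
  have hd' := ((hd i).differentiableOn two_ne_zero t ht.le).hasDerivWithinAt.hasDerivAt
    (Ici_mem_nhds ht)
  have hq := (hS.hasDerivWithinAt_zeta1 hmem i).hasDerivAt hJ
  refine (((hg'.add hd').sub (hz.hasDerivAt hJ)).sub (hq.const_mul (ks i))).congr_deriv ?_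
  simp only [pRemainder, zeta1]
  ring

theorem hasDerivAt_lyapunov {J : Set ℝ} (hS : S.IsSolution f g d a θbar θ ks c β t₀ J)
    (hg : ∀ i, ContDiff ℝ 1 (g i)) (hd : ∀ i, ContDiffOn ℝ 2 (d i) (Ici t₀)) (xs : Fin N → ℝ)
    (A : ℝ) {t : ℝ} (ht : t₀ < t) (hJ : J ∈ 𝓝 t) {s : Fin N → ℝ}
    (hs : ∀ i, s i ∈ sgnSet (S.zeta1 t i))
    (habs : ∀ i, DifferentiableAt ℝ (fun τ => |S.zeta1 τ i|) t)
    (hz : ∀ i, HasDerivWithinAt (fun τ => S.zhat τ i)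
      (ks i * c i * (S.x t i - S.xhat t i) + β i * s i) J t) :
    HasDerivAt (S.lyapunov g d θbar xs ks β A t₀)
      (S.lyapunovRate f g d a θbar θ xs ks c β A t₀ t s) t := by
  have hmem := mem_of_mem_nhds hJ
  have hq := fun i => (hS.hasDerivWithinAt_zeta1 hmem i).hasDerivAt hJ
  exact (hasDerivAt_seekingLyapunov
    (fun i => ((hS.hasDerivWithinAt_xhat hmem i).hasDerivAt hJ).sub_const (xs i))
    (fun i j => (hS.hasDerivWithinAt_etaHat hmem i j).hasDerivAt hJ)).add
      ((hasDerivAt_observerLyapunov hq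
        (fun i => hasDerivAt_abs_of_mem_sgnSet (hq i) (habs i) (hs i))
        (fun i => hS.hasDerivAt_pHat hg hd ht hJ (hz i))
        (fun i => hasDerivAt_derivWithin_Ici (hd i) ht)).const_mul A)

theorem lyapunov_le_mul_exp (hS : S.IsSolution f g d a θbar θ ks c β t₀ (Icc t₀ t₁))
    (ht : t₀ ≤ t₁) (hf : ∀ i, ContDiff ℝ 2 (f i)) (hg : ∀ i, ContDiff ℝ 1 (g i))
    (hd : ∀ i, ContDiffOn ℝ 2 (d i) (Ici t₀)) {xs : Fin N → ℝ} {A κ B : ℝ} (hκ : 0 ≤ κ)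
    (h0 : 0 ≤ S.lyapunov g d θbar xs ks β A t₀ t₀)
    (hB : S.lyapunov g d θbar xs ks β A t₀ t₀ < B)
    (hrate : ∀ t ∈ Ici t₀, ∀ s : Fin N → ℝ, (∀ i, s i ∈ sgnSet (S.zeta1 t i)) →
      S.lyapunov g d θbar xs ks β A t₀ t ≤ B →
      S.lyapunovRate f g d a θbar θ xs ks c β A t₀ t s ≤
        -κ * S.lyapunov g d θbar xs ks β A t₀ t) :
    S.lyapunov g d θbar xs ks β A t₀ t₁ ≤
      S.lyapunov g d θbar xs ks β A t₀ t₀ * Real.exp (-κ * (t₁ - t₀)) := by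
  refine le_mul_exp_of_barrier ht hκ
    (hS.absolutelyContinuousOnInterval_lyapunov ht hf hg hd xs A) h0 hB ?_
  filter_upwards [ae_all_iff.2 hS.deriv_zhat, ae_all_iff.2 fun i =>
    (absolutelyContinuousOnInterval_abs
      (hS.absolutelyContinuousOnInterval_zeta1 ht hg hd i)).ae_differentiableAt]
    with t hz habs hmem hle
  have htI := Ioo_subset_Icc_self hmem
  choose s hs hzs using fun i => hz i htI
  exact ⟨_, hrate t hmem.1.le s hs hle, hS.hasDerivAt_lyapunov hg hd xs A hmem.1
    (Icc_mem_nhds hmem.1 hmem.2) hs (fun i => habs i (uIcc_of_le ht ▸ htI)) hzs⟩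

end IsSolution
end Trajectory

section Estimates

variable {N : ℕ} {f g : Fin N → (Fin N → ℝ) → ℝ} {d : Fin N → ℝ → ℝ}
  {a θbar : Matrix (Fin N) (Fin N) ℝ} {m θ Λ R K : ℝ} {xs ks c β : Fin N → ℝ}

/-- `Λ` bounds the growth of the partial gradients and of the drifts on the ball of radius `R`
around `xs`, which will contain the actions, the observer states and the estimates. -/
structure LocalBounds (f g : Fin N → (Fin N → ℝ) → ℝ) (xs : Fin N → ℝ) (R Λ : ℝ) : Prop where
  nonneg : 0 ≤ Λ
  abs_partialOwn_sub_le : ∀ i, ∀ x ∈ Metric.closedBall xs R, ∀ z ∈ Metric.closedBall xs R,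
    |partialOwn f i x - partialOwn f i z| ≤ Λ * ‖x - z‖
  abs_sub_le : ∀ i, ∀ x ∈ Metric.closedBall xs R, ∀ z ∈ Metric.closedBall xs R,
    |g i x - g i z| ≤ Λ * ‖x - z‖
  norm_fderiv_le : ∀ i, ∀ x ∈ Metric.closedBall xs R, ‖fderiv ℝ (g i) x‖ ≤ Λ

theorem exists_norm_fderiv_le_on_closedBall {ι E : Type*} [Finite ι] [NormedAddCommGroup E]
    [NormedSpace ℝ E] [ProperSpace E] {F : ι → E → ℝ} (hF : ∀ i, ContDiff ℝ 1 (F i)) (x₀ : E)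
    (R : ℝ) : ∃ L, ∀ i, ∀ x ∈ Metric.closedBall x₀ R, ‖fderiv ℝ (F i) x‖ ≤ L := by
  choose C hC using fun i => (isCompact_closedBall x₀ R).exists_bound_of_continuousOn
    ((hF i).continuous_fderiv one_ne_zero).continuousOn
  obtain ⟨L, hL⟩ := Finite.exists_le C
  exact ⟨L, fun i x hx => (hC i x hx).trans (hL i)⟩

theorem exists_localBounds (hf : ∀ i, ContDiff ℝ 2 (f i)) (hg : ∀ i, ContDiff ℝ 1 (g i))
    (xs : Fin N → ℝ) (R : ℝ) : ∃ Λ, LocalBounds f g xs R Λ := by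
  have hf' := fun i => contDiff_partialOwn (hf i)
  obtain ⟨Lf, hLf⟩ := exists_norm_fderiv_le_on_closedBall hf' xs R
  obtain ⟨Lg, hLg⟩ := exists_norm_fderiv_le_on_closedBall hg xs R
  have hLf' : Lf ≤ max 0 (max Lf Lg) := (le_max_left _ _).trans (le_max_right _ _)
  have hLg' : Lg ≤ max 0 (max Lf Lg) := (le_max_right _ _).trans (le_max_right _ _)
  exact ⟨max 0 (max Lf Lg), le_max_left _ _,
    fun i x hx z hz => (convex_closedBall xs R).norm_image_sub_le_of_norm_fderiv_le
      (fun y _ => (hf' i).differentiable one_ne_zero y)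
      (fun y hy => (hLf i y hy).trans hLf') hz hx,
    fun i x hx z hz => (convex_closedBall xs R).norm_image_sub_le_of_norm_fderiv_le
      (fun y _ => (hg i).differentiable one_ne_zero y)
      (fun y hy => (hLg i y hy).trans hLg') hz hx,
    fun i x hx => (hLg i x hx).trans hLg'⟩

/-- Lower bounds on the observer gains: `c` dominates `ks`, the consensus gain `θ` and the growth
`Λ` of the drift, and `K` is an upper bound of `ks`, which is chosen before `c`. -/
structure ObserverGains (Λ K θ : ℝ) (ks c : Fin N → ℝ) : Prop where
  one_le_ks : ∀ i, 1 ≤ ks i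
  ks_le : ∀ i, ks i ≤ K
  ks_le_c : ∀ i, ks i ≤ c i
  theta_le_c : ∀ i, θ ≤ c i
  growth_le_c : ∀ i, 4 * N * Λ ≤ c i

theorem ObserverGains.one_le_c (h : ObserverGains Λ K θ ks c) (i : Fin N) : 1 ≤ c i :=
  (h.one_le_ks i).trans (h.ks_le_c i)

theorem mul_sum_abs_le_sum_mul_abs {ι : Type*} [Fintype ι] {k : ℝ} {c : ι → ℝ}
    (hc : ∀ i, k ≤ c i) (q : ι → ℝ) : k * ∑ i, |q i| ≤ ∑ i, c i * |q i| := by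
  rw [Finset.mul_sum]
  exact Finset.sum_le_sum fun i _ => mul_le_mul_of_nonneg_right (hc i) (abs_nonneg _)

theorem mul_norm_le_sum_mul_abs {ι : Type*} [Fintype ι] {k : ℝ} {c : ι → ℝ} (hk : 0 ≤ k)
    (hc : ∀ i, k ≤ c i) (q : ι → ℝ) : k * ‖q‖ ≤ ∑ i, c i * |q i| := by
  refine le_trans (mul_le_mul_of_nonneg_left ?_ hk) (mul_sum_abs_le_sum_mul_abs hc q)
  exact (pi_norm_le_iff_of_nonneg (by positivity)).2 fun i =>
    Finset.single_le_sum (f := fun i => |q i|) (fun i _ => abs_nonneg _) (Finset.mem_univ i)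

namespace Trajectory

variable {S : Trajectory N} {t : ℝ}

section ClosedBall

variable (hR : 2 * ‖(S.errHat xs t, S.etaHat t)‖ + ‖S.zeta1 t‖ ≤ R)
include hR

theorem xhat_mem_closedBall : S.xhat t ∈ Metric.closedBall xs R := by
  rw [mem_closedBall_iff_norm]
  change ‖S.errHat xs t‖ ≤ R
  linarith [norm_fst_le (S.errHat xs t, S.etaHat t), norm_nonneg (S.zeta1 t),
    norm_nonneg (S.errHat xs t, S.etaHat t)]

theorem x_mem_closedBall : S.x t ∈ Metric.closedBall xs R := by
  have hsplit : S.x t - xs = S.errHat xs t + S.zeta1 t := funext fun i => by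
    simp [errHat, zeta1]
  rw [mem_closedBall_iff_norm, hsplit]
  linarith [norm_add_le (S.errHat xs t) (S.zeta1 t), norm_fst_le (S.errHat xs t, S.etaHat t),
    norm_nonneg (S.errHat xs t, S.etaHat t)]

theorem y_mem_closedBall (i : Fin N) : S.y t i ∈ Metric.closedBall xs R := by
  have hsplit : S.y t i - xs = S.errHat xs t + S.etaHat t i := funext fun j => by
    simp [errHat, etaHat]
  rw [mem_closedBall_iff_norm, hsplit]
  linarith [norm_add_le (S.errHat xs t) (S.etaHat t i), norm_le_pi_norm (S.etaHat t) i,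
    norm_fst_le (S.errHat xs t, S.etaHat t), norm_snd_le (S.errHat xs t, S.etaHat t),
    norm_nonneg (S.zeta1 t)]

theorem equilibrium_mem_closedBall : xs ∈ Metric.closedBall xs R :=
  Metric.mem_closedBall_self ((by positivity :
    0 ≤ 2 * ‖(S.errHat xs t, S.etaHat t)‖ + ‖S.zeta1 t‖).trans hR)

variable (hL : LocalBounds f g xs R Λ)
include hL

theorem abs_partialOwn_y_le (hxs : pseudoGradient f xs = 0) (i : Fin N) :
    |partialOwn f i (S.y t i)| ≤ Λ * (‖S.errHat xs t‖ + ‖S.etaHat t‖) := by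
  have hsplit : S.y t i - xs = S.errHat xs t + S.etaHat t i := funext fun j => by
    simp [errHat, etaHat]
  have hlip := hL.abs_partialOwn_sub_le i _ (y_mem_closedBall hR i) _
    (equilibrium_mem_closedBall hR)
  rw [show partialOwn f i xs = 0 from congrFun hxs i, sub_zero, hsplit] at hlip
  refine hlip.trans (mul_le_mul_of_nonneg_left ((norm_add_le _ _).trans ?_) hL.nonneg)
  gcongr
  exact norm_le_pi_norm (S.etaHat t) i

theorem mul_sq_norm_errHat_sub_le (hm : 0 < m)
    (hmono : ∀ x z : Fin N → ℝ, m * ((x - z) ⬝ᵥ (x - z)) ≤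
      (x - z) ⬝ᵥ (pseudoGradient f x - pseudoGradient f z))
    (hxs : pseudoGradient f xs = 0) :
    m * ‖S.errHat xs t‖ ^ 2 - N * Λ * (‖S.errHat xs t‖ * ‖S.etaHat t‖) ≤
      S.errHat xs t ⬝ᵥ fun i => partialOwn f i (S.y t i) := by
  set w : Fin N → ℝ := fun i => partialOwn f i (S.y t i)
  have hgap : ∀ i, |(pseudoGradient f (S.xhat t) - w) i| ≤ Λ * ‖S.etaHat t‖ := fun i => by
    refine (hL.abs_partialOwn_sub_le i _ (xhat_mem_closedBall hR) _
      (y_mem_closedBall hR i)).trans (mul_le_mul_of_nonneg_left ?_ hL.nonneg)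
    rw [norm_sub_rev]
    exact norm_le_pi_norm (S.etaHat t) i
  have hmono' := hmono (S.xhat t) xs
  rw [hxs, sub_zero, show S.xhat t - xs = S.errHat xs t from rfl] at hmono'
  have hcross : S.errHat xs t ⬝ᵥ (pseudoGradient f (S.xhat t) - w) ≤
      N * Λ * (‖S.errHat xs t‖ * ‖S.etaHat t‖) := by
    refine (dotProduct_le_norm_mul_sum_abs _ _).trans ((mul_le_mul_of_nonneg_left
      (sum_abs_le_card_mul hgap) (norm_nonneg _)).trans_eq ?_)
    rw [Fintype.card_fin]
    ring
  rw [dotProduct_sub] at hcross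
  linarith [mul_le_mul_of_nonneg_left (sq_norm_le_dotProduct_self (S.errHat xs t)) hm.le]

theorem abs_gInc_le (i : Fin N) : |S.gInc g t i| ≤ Λ * ‖S.zeta1 t‖ :=
  hL.abs_sub_le i _ (x_mem_closedBall hR) _ (xhat_mem_closedBall hR)

variable (hgain : ObserverGains Λ K θ ks c)
include hgain

theorem abs_gInc_le_div (i : Fin N) : |S.gInc g t i| ≤
    (∑ j, c j * |S.zeta1 t j|) / (4 * Fintype.card (Fin N)) := by
  have hN : (0 : ℝ) < N := Nat.cast_pos.2 i.pos
  rw [Fintype.card_fin, le_div_iff₀ (by positivity)]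
  calc |S.gInc g t i| * (4 * N) ≤ Λ * ‖S.zeta1 t‖ * (4 * N) := by
        gcongr
        exact abs_gInc_le hR hL i
    _ = 4 * N * Λ * ‖S.zeta1 t‖ := by ring
    _ ≤ _ := mul_norm_le_sum_mul_abs (by have := hL.nonneg; positivity) hgain.growth_le_c _

theorem norm_xhatRate_le (hxs : pseudoGradient f xs = 0) :
    ‖S.xhatRate f ks c t‖ ≤ Λ * (‖S.errHat xs t‖ + ‖S.etaHat t‖) +
      2 * ∑ j, c j * |S.zeta1 t j| := by
  have hcq : ∀ i, 0 ≤ c i * |S.zeta1 t i| := fun i =>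
    mul_nonneg (zero_le_one.trans (hgain.one_le_c i)) (abs_nonneg _)
  have hΛ := hL.nonneg
  refine (pi_norm_le_iff_of_nonneg (add_nonneg (by positivity)
    (mul_nonneg two_pos.le (Finset.sum_nonneg fun i _ => hcq i)))).2 fun i => ?_
  have hsingle := Finset.single_le_sum (fun i _ => hcq i) (Finset.mem_univ i)
  have hks := mul_le_mul_of_nonneg_right (hgain.ks_le_c i) (abs_nonneg (S.zeta1 t i))
  refine (abs_add_le _ _).trans (add_le_add ?_ ?_)
  · rw [abs_neg]
    exact abs_partialOwn_y_le hR hL hxs i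
  · rw [abs_mul, abs_of_nonneg (by linarith [hgain.one_le_ks i, hgain.ks_le_c i])]
    linarith

theorem abs_pRemainder_le (hxs : pseudoGradient f xs = 0) (i : Fin N) :
    |S.pRemainder f g ks c t i| ≤ (2 * Λ + K + 2 * Λ ^ 2) *
      (∑ j, c j * |S.zeta1 t j| + ‖(S.errHat xs t, S.etaHat t)‖) := by
  set Q := ∑ j, c j * |S.zeta1 t j|
  set σ := ‖(S.errHat xs t, S.etaHat t)‖
  have hΛ := hL.nonneg
  have hks : 0 ≤ ks i := zero_le_one.trans (hgain.one_le_ks i)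
  have hK : 0 ≤ K := hks.trans (hgain.ks_le i)
  have hQ : 0 ≤ Q := Finset.sum_nonneg fun j _ =>
    mul_nonneg (zero_le_one.trans (hgain.one_le_c j)) (abs_nonneg _)
  have hσ : ‖S.errHat xs t‖ + ‖S.etaHat t‖ ≤ 2 * σ := by
    linarith [norm_fst_le (S.errHat xs t, S.etaHat t), norm_snd_le (S.errHat xs t, S.etaHat t)]
  have hderiv : |fderiv ℝ (g i) (S.xhat t) (S.xhatRate f ks c t)| ≤ Λ * (Λ * (2 * σ) + 2 * Q) :=
    calc _ ≤ ‖fderiv ℝ (g i) (S.xhat t)‖ * ‖S.xhatRate f ks c t‖ :=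
          ContinuousLinearMap.le_opNorm _ _
      _ ≤ Λ * (Λ * (2 * σ) + 2 * Q) := by
        gcongr
        · exact hL.norm_fderiv_le i _ (xhat_mem_closedBall hR)
        · exact (norm_xhatRate_le hR hL hgain hxs).trans (by gcongr)
  have hinc : |ks i * S.gInc g t i| ≤ K * Q := by
    have hcard : (1 : ℝ) ≤ 4 * Fintype.card (Fin N) := by
      rw [Fintype.card_fin]
      linarith [(Nat.one_le_cast (α := ℝ)).2 i.pos]
    rw [abs_mul, abs_of_nonneg hks]
    exact mul_le_mul (hgain.ks_le i)
      ((abs_gInc_le_div hR hL hgain i).trans (div_le_self hQ hcard)) (abs_nonneg _) hK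
  have hcross : 0 ≤ K * σ + 2 * Λ * σ + 2 * Λ ^ 2 * Q := by positivity
  rw [pRemainder]
  linarith [abs_sub (fderiv ℝ (g i) (S.xhat t) (S.xhatRate f ks c t)) (ks i * S.gInc g t i)]

end ClosedBall

end Trajectory
end Estimates

section Decay

variable {N : ℕ} {f g : Fin N → (Fin N → ℝ) → ℝ} {d : Fin N → ℝ → ℝ}
  {a θbar : Matrix (Fin N) (Fin N) ℝ} {m θ Λ R K : ℝ} {xs ks c β : Fin N → ℝ}

/-- The constants chosen before the gains: the weight `A` of the observer in the Lyapunov function,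
the level `B` below which solutions stay, the radius `R` of a ball which contains them, the
admissible feedback `μ` of the seeking errors to the observer, and the decay rate `κ`. -/
structure DesignConstants (m C C₁ A B R μ κ : ℝ) : Prop where
  C_nonneg : 0 ≤ C
  C₁_pos : 0 < C₁
  one_le_A : 1 ≤ A
  mul_sqrt_le : C * √(C₁ * B) ≤ A / 4
  radius_le : 2 * √(C₁ * B) + 2 * B ≤ R
  μ_pos : 0 < μ
  mul_μ_le : A * μ ≤ m / 4
  κ_pos : 0 < κ
  κ_mul_le : κ * C₁ ≤ m / 4
  κ_le : κ ≤ 1 / 6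

theorem exists_mul_sqrt_le {C : ℝ} (C₁ b₀ b₁ : ℝ) (hC₁ : 0 ≤ C₁) (hb₀ : 0 ≤ b₀) (hb₁ : 0 ≤ b₁) :
    ∃ A ≥ 1, C * √(C₁ * (b₀ + b₁ * A)) ≤ A / 4 := by
  set s := 16 * C ^ 2 * (C₁ * (b₀ + b₁)) with hs
  have hs0 : 0 ≤ s := by positivity
  refine ⟨1 + s, le_add_of_nonneg_right hs0, le_of_abs_le (abs_le_of_sq_le_sq ?_ (by positivity))⟩
  rw [mul_pow, Real.sq_sqrt (by positivity)]
  calc C ^ 2 * (C₁ * (b₀ + b₁ * (1 + s))) ≤ C ^ 2 * (C₁ * ((b₀ + b₁) * (1 + s))) := by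
        rw [add_mul]
        gcongr
        exact le_mul_of_one_le_right hb₀ (le_add_of_nonneg_right hs0)
    _ = s * (1 + s) / 16 := by rw [hs]; ring
    _ ≤ (1 + s) * (1 + s) / 16 := by gcongr; exact le_add_of_nonneg_left zero_le_one
    _ = ((1 + s) / 4) ^ 2 := by ring

theorem exists_designConstants {m C C₁ b₀ b₁ : ℝ} (hm : 0 < m) (hC : 0 ≤ C) (hC₁ : 0 < C₁)
    (hb₀ : 0 ≤ b₀) (hb₁ : 0 ≤ b₁) (r : ℝ) :
    ∃ A B R μ κ, DesignConstants m C C₁ A B R μ κ ∧ b₀ + b₁ * A < B ∧ r ≤ R := by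
  obtain ⟨A, hA, hCA⟩ := exists_mul_sqrt_le (C := C) C₁ (b₀ + 1) b₁ hC₁.le (by positivity) hb₁
  have hA0 : 0 < A := one_pos.trans_le hA
  set B := b₀ + 1 + b₁ * A with hB
  refine ⟨A, B, max r (2 * √(C₁ * B) + 2 * B), m / 4 / A, min (1 / 6) (m / 4 / C₁),
    ⟨hC, hC₁, hA, hCA, le_max_right _ _, by positivity, (mul_div_cancel₀ _ hA0.ne').le,
      by positivity, (le_div_iff₀ hC₁).1 (min_le_right _ _), min_le_left _ _⟩, ?_, le_max_left _ _⟩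
  linarith [hB]

theorem add_mul_le_neg_mul_of_dissipation {C C₁ A κ μ σ Q V W V' W' P : ℝ} (hQ : 0 ≤ Q)
    (hP : 0 ≤ P) (hA : 0 ≤ A) (hκ : 0 ≤ κ) (hV' : V' ≤ -(m / 2) * σ ^ 2 + C * σ * Q)
    (hW' : W' ≤ -P - Q / 2 + μ * σ ^ 2) (hV : V ≤ C₁ * σ ^ 2) (hW : W ≤ P + 3 / 2 * Q)
    (hC : C * σ ≤ A / 4) (hμ : A * μ ≤ m / 4) (hκC : κ * C₁ ≤ m / 4) (hκ' : κ ≤ 1 / 6) :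
    V' + A * W' ≤ -κ * (V + A * W) := by
  have hAQ := mul_nonneg hA hQ
  have hAP := mul_nonneg hA hP
  have hinput := mul_le_mul_of_nonneg_right hC hQ
  have hobserver := mul_le_mul_of_nonneg_left hW' hA
  have hfeedback := mul_le_mul_of_nonneg_right hμ (sq_nonneg σ)
  have hκV := (mul_le_mul_of_nonneg_left hV hκ).trans_eq (mul_assoc _ _ _).symm |>.trans
    (mul_le_mul_of_nonneg_right hκC (sq_nonneg σ))
  have hκW := mul_le_mul_of_nonneg_left (mul_le_mul_of_nonneg_left hW hA) hκ
  have hκP := mul_le_mul_of_nonneg_right hκ' hAP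
  have hκQ := mul_le_mul_of_nonneg_right hκ' hAQ
  linarith

namespace Trajectory

variable {S : Trajectory N} {t t₀ A B C C₁ M μ κ : ℝ}

theorem seekingRate_le (hR : 2 * ‖(S.errHat xs t, S.etaHat t)‖ + ‖S.zeta1 t‖ ≤ R)
    (hL : LocalBounds f g xs R Λ) (hgain : ObserverGains Λ K θ ks c) (hm : 0 < m)
    (hmono : ∀ x z : Fin N → ℝ, m * ((x - z) ⬝ᵥ (x - z)) ≤
      (x - z) ⬝ᵥ (pseudoGradient f x - pseudoGradient f z))
    (hxs : pseudoGradient f xs = 0) (hseek : SeekingDissipation a θbar θ m Λ C) :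
    seekingRate θbar (S.errHat xs t) (S.xhatRate f ks c t) (S.etaHat t)
        (fun i j => consensusField a θbar θ (S.etaHat t) (S.zeta1 t) i j -
          S.xhatRate f ks c t j) ≤
      -(m / 2) * ‖(S.errHat xs t, S.etaHat t)‖ ^ 2 +
        C * ‖(S.errHat xs t, S.etaHat t)‖ * ∑ i, c i * |S.zeta1 t i| := by
  refine hseek _ _ (fun i => (ks i + c i) * S.zeta1 t i) _ _ _
    (mul_sq_norm_errHat_sub_le hR hL hm hmono hxs) (abs_partialOwn_y_le hR hL hxs) ?_
    (mul_sum_abs_le_sum_mul_abs hgain.theta_le_c _)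
  rw [Finset.mul_sum]
  refine Finset.sum_le_sum fun i _ => ?_
  rw [abs_mul, abs_of_nonneg (by linarith [hgain.one_le_ks i, hgain.ks_le_c i])]
  linarith [mul_le_mul_of_nonneg_right (hgain.ks_le_c i) (abs_nonneg (S.zeta1 t i))]

theorem lyapunov_bounds (hC₁ : 0 < C₁) (hcomp : SeekingComparison θbar C₁) (hA : 1 ≤ A)
    (hβ : ∀ i, 0 < β i) (hd : ∀ i, 2 * |derivWithin (d i) (Ici t₀) t| ≤ β i) :
    ‖(S.errHat xs t, S.etaHat t)‖ ^ 2 ≤ C₁ * S.lyapunov g d θbar xs ks β A t₀ t ∧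
      ∀ i, S.pHat g d ks t i ^ 2 / (2 * β i) + |S.zeta1 t i| / 2 ≤
        S.lyapunov g d θbar xs ks β A t₀ t := by
  have hcomp' := (hcomp (S.errHat xs t) (S.etaHat t)).2
  have hseek : 0 ≤ seekingLyapunov θbar (S.errHat xs t) (S.etaHat t) :=
    nonneg_of_mul_nonneg_right ((sq_nonneg _).trans hcomp') hC₁
  have hobs := observerLyapunov_nonneg (q := S.zeta1 t) (p := S.pHat g d ks t) hβ hd
  refine ⟨hcomp'.trans (mul_le_mul_of_nonneg_left (le_add_of_nonneg_right
    (mul_nonneg (zero_le_one.trans hA) hobs)) hC₁.le), fun i => ?_⟩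
  exact (apply_le_observerLyapunov hβ hd i).trans ((le_mul_of_one_le_left hobs hA).trans
    (le_add_of_nonneg_left hseek))

theorem lyapunov_nonneg (hC₁ : 0 < C₁) (hcomp : SeekingComparison θbar C₁) (hA : 1 ≤ A)
    (hβ : ∀ i, 0 < β i) (hd : ∀ i, 2 * |derivWithin (d i) (Ici t₀) t| ≤ β i) :
    0 ≤ S.lyapunov g d θbar xs ks β A t₀ t :=
  nonneg_of_mul_nonneg_right ((sq_nonneg _).trans (lyapunov_bounds hC₁ hcomp hA hβ hd).1) hC₁

theorem norm_le_of_lyapunov_le {U : ℝ} (hC₁ : 0 < C₁) (hcomp : SeekingComparison θbar C₁)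
    (hA : 1 ≤ A) (hβ : ∀ i, 0 < β i) (hd : ∀ i, 2 * |derivWithin (d i) (Ici t₀) t| ≤ β i)
    (hU : S.lyapunov g d θbar xs ks β A t₀ t ≤ U) :
    ‖(S.errHat xs t, S.etaHat t)‖ ≤ √(C₁ * U) ∧ ‖S.zeta1 t‖ ≤ 2 * U ∧
      ∀ i, S.pHat g d ks t i ^ 2 / (2 * β i) ≤ U := by
  obtain ⟨hσ, hpq⟩ := lyapunov_bounds (S := S) (g := g) (xs := xs) (ks := ks) hC₁ hcomp hA hβ hd
  have hU0 := (lyapunov_nonneg hC₁ hcomp hA hβ hd).trans hU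
  refine ⟨Real.le_sqrt_of_sq_le (hσ.trans (mul_le_mul_of_nonneg_left hU hC₁.le)),
    (pi_norm_le_iff_of_nonneg (by positivity)).2 fun i => ?_, fun i => ?_⟩
  · have hp : 0 ≤ S.pHat g d ks t i ^ 2 / (2 * β i) :=
      div_nonneg (sq_nonneg _) (by linarith [hβ i])
    rw [Real.norm_eq_abs]
    linarith [hpq i]
  · linarith [hpq i, abs_nonneg (S.zeta1 t i)]

theorem observerRate_le (hR : 2 * ‖(S.errHat xs t, S.etaHat t)‖ + ‖S.zeta1 t‖ ≤ R)
    (hL : LocalBounds f g xs R Λ) (hgain : ObserverGains Λ K θ ks c)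
    (hxs : pseudoGradient f xs = 0)
    (hobs : ObserverDissipation β M B (2 * Λ + K + 2 * Λ ^ 2) μ) {s : Fin N → ℝ}
    (hs : ∀ i, s i ∈ sgnSet (S.zeta1 t i)) (hp : ∀ i, S.pHat g d ks t i ^ 2 / (2 * β i) ≤ B)
    (hd : ∀ i, |derivWithin (d i) (Ici t₀) t| ≤ M ∧
      |iteratedDerivWithin 2 (d i) (Ici t₀) t| ≤ M) :
    observerRate β s (S.zeta1 t) (S.pHat g d ks t) (fun i => derivWithin (d i) (Ici t₀) t)
        (fun i => S.pHat g d ks t i + S.gInc g t i - c i * S.zeta1 t i)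
        (fun i => -ks i * S.pHat g d ks t i + S.pRemainder f g ks c t i +
          derivWithin (d i) (Ici t₀) t - β i * s i)
        (fun i => iteratedDerivWithin 2 (d i) (Ici t₀) t) ≤
      -∑ i, S.pHat g d ks t i ^ 2 / (2 * β i) - (∑ i, c i * |S.zeta1 t i|) / 2 +
        μ * ‖(S.errHat xs t, S.etaHat t)‖ ^ 2 :=
  hobs ks c s _ _ _ _ _ _ _ hgain.one_le_ks hgain.one_le_c hs (abs_gInc_le_div hR hL hgain)
    (abs_pRemainder_le hR hL hgain hxs) hp (fun i => (hd i).1) fun i => (hd i).2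

theorem lyapunovRate_le (hconst : DesignConstants m C C₁ A B R μ κ)
    (hcomp : SeekingComparison θbar C₁) (hL : LocalBounds f g xs R Λ)
    (hgain : ObserverGains Λ K θ ks c) (hm : 0 < m)
    (hmono : ∀ x z : Fin N → ℝ, m * ((x - z) ⬝ᵥ (x - z)) ≤
      (x - z) ⬝ᵥ (pseudoGradient f x - pseudoGradient f z))
    (hxs : pseudoGradient f xs = 0) (hseek : SeekingDissipation a θbar θ m Λ C)
    (hobs : ObserverDissipation β M B (2 * Λ + K + 2 * Λ ^ 2) μ)
    (hβ : ∀ i, 0 < β i) (hβM : ∀ i, 2 * M ≤ β i)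
    (hd : ∀ i, |derivWithin (d i) (Ici t₀) t| ≤ M ∧
      |iteratedDerivWithin 2 (d i) (Ici t₀) t| ≤ M) {s : Fin N → ℝ}
    (hs : ∀ i, s i ∈ sgnSet (S.zeta1 t i)) (hV : S.lyapunov g d θbar xs ks β A t₀ t ≤ B) :
    S.lyapunovRate f g d a θbar θ xs ks c β A t₀ t s ≤
      -κ * S.lyapunov g d θbar xs ks β A t₀ t := by
  have hdβ : ∀ i, 2 * |derivWithin (d i) (Ici t₀) t| ≤ β i := fun i => by
    linarith [(hd i).1, hβM i]
  have hA := zero_le_one.trans hconst.one_le_A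
  obtain ⟨hσ, hq, hp⟩ := norm_le_of_lyapunov_le hconst.C₁_pos hcomp hconst.one_le_A hβ hdβ hV
  have hR : 2 * ‖(S.errHat xs t, S.etaHat t)‖ + ‖S.zeta1 t‖ ≤ R := by
    linarith [hconst.radius_le]
  refine add_mul_le_neg_mul_of_dissipation (Finset.sum_nonneg fun i _ => mul_nonneg
    (zero_le_one.trans (hgain.one_le_c i)) (abs_nonneg _)) (Finset.sum_nonneg fun i _ =>
      div_nonneg (sq_nonneg _) (by linarith [hβ i])) hA hconst.κ_pos.le
    (seekingRate_le hR hL hgain hm hmono hxs hseek) (observerRate_le hR hL hgain hxs hobs hs hp hd)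
    (hcomp _ _).1 ((observerLyapunov_le hβ hdβ).trans ?_) ?_ hconst.mul_μ_le hconst.κ_mul_le
    hconst.κ_le
  · linarith [mul_sum_abs_le_sum_mul_abs hgain.one_le_c (S.zeta1 t)]
  · exact (mul_le_mul_of_nonneg_left hσ hconst.C_nonneg).trans hconst.mul_sqrt_le

end Trajectory
end Decay

theorem norm_le_sqrt_card_mul {ι : Type*} [Fintype ι] {r : ℝ} (hr : 0 ≤ r)
    {x : EuclideanSpace ℝ ι} (hx : ∀ i, ‖x i‖ ≤ r) : ‖x‖ ≤ √(Fintype.card ι) * r := by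
  rw [EuclideanSpace.norm_eq, Real.sqrt_le_left (by positivity), mul_pow,
    Real.sq_sqrt (Nat.cast_nonneg _)]
  simpa using Finset.sum_le_card_nsmul Finset.univ _ _ fun i _ =>
    pow_le_pow_left₀ (norm_nonneg _) (hx i) 2

section ErrorBounds

variable {N : ℕ} {f g : Fin N → (Fin N → ℝ) → ℝ} {d : Fin N → ℝ → ℝ}
  {a θbar : Matrix (Fin N) (Fin N) ℝ} {θ Λ R K v t t₀ : ℝ} {xs ks c β : Fin N → ℝ} {J : Set ℝ}
  {S : Trajectory N}

namespace Trajectory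

theorem norm_zeta1_le_norm_error : ‖S.zeta1 t‖ ≤ ‖S.error g d xs c J t‖ :=
  (pi_norm_le_iff_of_nonneg (norm_nonneg _)).2 fun i =>
    PiLp.norm_apply_le (S.error g d xs c J t) (Sum.inl i)

theorem norm_errHat_etaHat_le :
    ‖(S.errHat xs t, S.etaHat t)‖ ≤ 2 * ‖S.error g d xs c J t‖ := by
  have hcomp := PiLp.norm_apply_le (S.error g d xs c J t)
  have hq := fun i => (norm_le_pi_norm (S.zeta1 t) i).trans
    (norm_zeta1_le_norm_error (g := g) (d := d) (xs := xs) (c := c) (J := J))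
  refine norm_prod_le_iff.2 ⟨(pi_norm_le_iff_of_nonneg (by positivity)).2 fun i => ?_,
    (pi_norm_le_iff_of_nonneg (by positivity)).2 fun i =>
      (pi_norm_le_iff_of_nonneg (by positivity)).2 fun j => ?_⟩
  · have hsplit : S.errHat xs t i = S.xi xs t i - S.zeta1 t i := by simp [errHat, xi, zeta1]
    have hxi : ‖S.xi xs t i‖ ≤ _ := hcomp (.inr (.inr (.inl i)))
    change ‖S.errHat xs t i‖ ≤ _
    rw [hsplit]
    linarith [norm_sub_le (S.xi xs t i) (S.zeta1 t i), hq i]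
  · have hsplit : S.etaHat t i j = S.eta t i j + S.zeta1 t j := by simp [etaHat, eta, zeta1]
    have heta : ‖S.eta t i j‖ ≤ _ := hcomp (.inr (.inr (.inr (.inl (i, j)))))
    change ‖S.etaHat t i j‖ ≤ _
    rw [hsplit]
    linarith [norm_add_le (S.eta t i j) (S.zeta1 t j), hq j]

namespace IsSolution

variable (hS : S.IsSolution f g d a θbar θ ks c β t₀ J) (ht : t ∈ J) (hJ : UniqueDiffOn ℝ J)
include hS ht hJ

theorem abs_pHat_le (hL : LocalBounds f g xs R Λ) (hv : ‖S.error g d xs c J t‖ ≤ v)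
    (hR : 5 * v ≤ R) (i : Fin N) : |S.pHat g d ks t i| ≤ (1 + Λ) * v := by
  have hq := norm_zeta1_le_norm_error.trans hv
  have hσ := norm_errHat_etaHat_le.trans (mul_le_mul_of_nonneg_left hv two_pos.le)
  have hinc : |S.gInc g t i| ≤ Λ * v :=
    (abs_gInc_le (xs := xs) (by linarith) hL i).trans (mul_le_mul_of_nonneg_left hq hL.nonneg)
  have hgamma : |S.gamma c J t i| ≤ v :=
    (PiLp.norm_apply_le (S.error g d xs c J t) (.inr (.inr (.inr (.inr i))))).trans hv
  have hsplit : S.pHat g d ks t i = S.gamma c J t i - S.gInc g t i := by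
    rw [hS.gamma_eq ht hJ, add_sub_cancel_right]
  rw [hsplit]
  linarith [abs_sub (S.gamma c J t i) (S.gInc g t i)]

theorem lyapunov_le_of_norm_error_le {A C₁ : ℝ} (hA : 0 ≤ A) (hC₁ : 0 ≤ C₁)
    (hcomp : SeekingComparison θbar C₁) (hL : LocalBounds f g xs R Λ)
    (hv : ‖S.error g d xs c J t‖ ≤ v) (hR : 5 * v ≤ R) (hβ : ∀ i, 0 < β i)
    (hβv : ∀ i, (1 + Λ) ^ 2 * v ≤ β i) (hd : ∀ i, 2 * |derivWithin (d i) (Ici t₀) t| ≤ β i) :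
    S.lyapunov g d θbar xs ks β A t₀ t ≤ 4 * C₁ * v ^ 2 + 2 * N * v * A := by
  have hv0 : 0 ≤ v := (norm_nonneg _).trans hv
  have hseek : seekingLyapunov θbar (S.errHat xs t) (S.etaHat t) ≤ C₁ * (2 * v) ^ 2 := by
    refine (hcomp _ _).1.trans ?_
    gcongr
    exact norm_errHat_etaHat_le.trans (mul_le_mul_of_nonneg_left hv two_pos.le)
  have hp : ∀ i, S.pHat g d ks t i ^ 2 / (2 * β i) ≤ v / 2 := fun i => by
    rw [div_le_iff₀ (by linarith [hβ i])]
    calc S.pHat g d ks t i ^ 2 ≤ ((1 + Λ) * v) ^ 2 :=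
          sq_le_sq.2 ((hS.abs_pHat_le ht hJ hL hv hR i).trans (le_abs_self _))
      _ = (1 + Λ) ^ 2 * v * v := by ring
      _ ≤ β i * v := mul_le_mul_of_nonneg_right (hβv i) hv0
      _ = v / 2 * (2 * β i) := by ring
  have hpsum : ∑ i, S.pHat g d ks t i ^ 2 / (2 * β i) ≤ N * (v / 2) := by
    simpa using Finset.sum_le_card_nsmul Finset.univ _ _ fun i _ => hp i
  have hqsum : ∑ i, |S.zeta1 t i| ≤ N * v := by
    simpa using sum_abs_le_card_mul fun i =>
      (norm_le_pi_norm (S.zeta1 t) i).trans (norm_zeta1_le_norm_error.trans hv)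
  have hobs := mul_le_mul_of_nonneg_left
    ((observerLyapunov_le (q := S.zeta1 t) (p := S.pHat g d ks t) hβ hd).trans
      (add_le_add hpsum (mul_le_mul_of_nonneg_left hqsum (by norm_num)))) hA
  rw [lyapunov]
  linarith

theorem norm_error_le {ρ : ℝ} (hΛ : 0 ≤ Λ) (hks : ∀ i, 0 ≤ ks i) (hK : ∀ i, ks i ≤ K)
    (hK0 : 0 ≤ K) (hσ : ‖(S.errHat xs t, S.etaHat t)‖ ≤ ρ) (hq : ‖S.zeta1 t‖ ≤ ρ)
    (hp : ∀ i, |S.pHat g d ks t i| ≤ ρ) (hinc : ∀ i, |S.gInc g t i| ≤ Λ * ρ) :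
    ‖S.error g d xs c J t‖ ≤
      √(Fintype.card (Fin N ⊕ Fin N ⊕ Fin N ⊕ (Fin N × Fin N) ⊕ Fin N)) *
        ((2 + Λ + K) * ρ) := by
  have hρ : 0 ≤ ρ := (norm_nonneg _).trans hq
  have hΛρ := mul_nonneg hΛ hρ
  have hKρ := mul_nonneg hK0 hρ
  have hzeta : ∀ i, |S.zeta1 t i| ≤ ρ := fun i => (norm_le_pi_norm _ i).trans hq
  have he : ∀ i, |S.errHat xs t i| ≤ ρ := fun i =>
    (norm_le_pi_norm (S.errHat xs t) i).trans ((norm_fst_le _).trans hσ)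
  have hη : ∀ i j, |S.etaHat t i j| ≤ ρ := fun i j => (norm_le_pi_norm (S.etaHat t i) j).trans
    ((norm_le_pi_norm (S.etaHat t) i).trans ((norm_snd_le _).trans hσ))
  refine norm_le_sqrt_card_mul (by positivity) ?_
  rintro (i | i | i | ⟨i, j⟩ | i)
  · change |S.zeta1 t i| ≤ _
    linarith [hzeta i]
  · have hsplit : S.zeta2 g d t i = S.pHat g d ks t i + S.gInc g t i + ks i * S.zeta1 t i := by
      simp only [zeta2, pHat, gInc]
      ring
    have hdamp : |ks i * S.zeta1 t i| ≤ K * ρ := by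
      rw [abs_mul, abs_of_nonneg (hks i)]
      exact mul_le_mul (hK i) (hzeta i) (abs_nonneg _) hK0
    change |S.zeta2 g d t i| ≤ _
    rw [hsplit]
    linarith [abs_add_three (S.pHat g d ks t i) (S.gInc g t i) (ks i * S.zeta1 t i), hp i, hinc i]
  · have hsplit : S.xi xs t i = S.errHat xs t i + S.zeta1 t i := by simp [errHat, xi, zeta1]
    change |S.xi xs t i| ≤ _
    rw [hsplit]
    linarith [abs_add_le (S.errHat xs t i) (S.zeta1 t i), he i, hzeta i]
  · have hsplit : S.eta t i j = S.etaHat t i j - S.zeta1 t j := by simp [etaHat, eta, zeta1]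
    change |S.eta t i j| ≤ _
    rw [hsplit]
    linarith [abs_sub (S.etaHat t i j) (S.zeta1 t j), hη i j, hzeta j]
  · change |S.gamma c J t i| ≤ _
    rw [hS.gamma_eq ht hJ]
    linarith [abs_add_le (S.pHat g d ks t i) (S.gInc g t i), hp i, hinc i]

end IsSolution
end Trajectory
end ErrorBounds

section ClosedLoop

variable {N : ℕ} {f g : Fin N → (Fin N → ℝ) → ℝ} {d : Fin N → ℝ → ℝ}
  {a θbar : Matrix (Fin N) (Fin N) ℝ} {m θ t₀ v C C₁ A B R μ κ K M Λ : ℝ}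
  {xs ks c β : Fin N → ℝ}

/-- Along the solutions of the closed loop which start with an error of norm at most `v`, the error
decays at a uniform exponential rate. The interval `J` of existence may be bounded, so this covers
both the absence of finite escape times and the convergence to `0`. -/
def IsExponentiallyAttracting (f g : Fin N → (Fin N → ℝ) → ℝ) (d : Fin N → ℝ → ℝ)
    (a θbar : Matrix (Fin N) (Fin N) ℝ) (θ : ℝ) (ks c β xs : Fin N → ℝ) (t₀ v : ℝ) : Prop :=
  ∃ κ > 0, ∃ D, ∀ (J : Set ℝ) (S : Trajectory N), IsLeast J t₀ → J.OrdConnected →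
    UniqueDiffOn ℝ J → S.IsSolution f g d a θbar θ ks c β t₀ J →
    ‖S.error g d xs c J t₀‖ ≤ v →
    ∀ t ∈ J, ‖S.error g d xs c J t‖ ≤ D * Real.exp (-κ * (t - t₀))

namespace IsExponentiallyAttracting

theorem exists_norm_error_le (h : IsExponentiallyAttracting f g d a θbar θ ks c β xs t₀ v) {T : ℝ}
    (hT : t₀ < T) {S : Trajectory N} (hS : S.IsSolution f g d a θbar θ ks c β t₀ (Ico t₀ T))
    (hv : ‖S.error g d xs c (Ico t₀ T) t₀‖ ≤ v) :
    ∃ C, ∀ t ∈ Ico t₀ T, ‖S.error g d xs c (Ico t₀ T) t‖ ≤ C := by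
  obtain ⟨κ, hκ, D, hD⟩ := h
  refine ⟨|D|, fun t ht => (hD _ S (isLeast_Ico hT) ordConnected_Ico (uniqueDiffOn_Ico t₀ T) hS hv
    t ht).trans ?_⟩
  have hexp : Real.exp (-κ * (t - t₀)) ≤ 1 :=
    Real.exp_le_one_iff.2 (by nlinarith [sub_nonneg.2 ht.1])
  calc D * Real.exp (-κ * (t - t₀)) ≤ |D| * 1 := by
        gcongr
        exact le_abs_self D
    _ = |D| := mul_one _

theorem tendsto_norm_error (h : IsExponentiallyAttracting f g d a θbar θ ks c β xs t₀ v)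
    {S : Trajectory N} (hS : S.IsSolution f g d a θbar θ ks c β t₀ (Ici t₀))
    (hv : ‖S.error g d xs c (Ici t₀) t₀‖ ≤ v) :
    Tendsto (fun t => ‖S.error g d xs c (Ici t₀) t‖) atTop (𝓝 0) := by
  obtain ⟨κ, hκ, D, hD⟩ := h
  have hexp : Tendsto (fun t => D * Real.exp (-κ * (t - t₀))) atTop (𝓝 0) := by
    have htime : Tendsto (fun t => t - t₀) atTop atTop := by
      simpa only [sub_eq_add_neg, id] using tendsto_atTop_add_const_right _ (-t₀) tendsto_id
    simpa only [mul_zero, Function.comp_def] using (Real.tendsto_exp_atBot.comp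
      (htime.const_mul_atTop_of_neg (neg_neg_of_pos hκ))).const_mul D
  refine squeeze_zero' (.of_forall fun _ => norm_nonneg _) ?_ hexp
  filter_upwards [eventually_ge_atTop t₀] with t ht
  exact hD _ S isLeast_Ici ordConnected_Ici (uniqueDiffOn_Ici t₀) hS hv t ht

end IsExponentiallyAttracting

namespace Trajectory.IsSolution

variable {S : Trajectory N} {J : Set ℝ} {t : ℝ}
  (hS : S.IsSolution f g d a θbar θ ks c β t₀ J) (ht : t ∈ J) (hJ : UniqueDiffOn ℝ J)
include hS ht hJ

theorem norm_error_le_of_lyapunov_le {E b : ℝ} (hconst : DesignConstants m C C₁ A B R μ κ)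
    (hcomp : SeekingComparison θbar C₁) (hL : LocalBounds f g xs R Λ) (hB : 0 ≤ B)
    (hgain : ObserverGains Λ K θ ks c) (hK : 0 ≤ K) (hβ : ∀ i, 0 < β i) (hb : ∀ i, β i ≤ b)
    (hd : ∀ i, 2 * |derivWithin (d i) (Ici t₀) t| ≤ β i) (hE : 0 ≤ E) (hE' : E ≤ 1)
    (hV : S.lyapunov g d θbar xs ks β A t₀ t ≤ B * E ^ 2) :
    ‖S.error g d xs c J t‖ ≤
      √(Fintype.card (Fin N ⊕ Fin N ⊕ Fin N ⊕ (Fin N × Fin N) ⊕ Fin N)) *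
        ((2 + Λ + K) * ((√(C₁ * B) + 2 * B + √(2 * b * B)) * E)) := by
  obtain ⟨hσ, hq, hp⟩ := norm_le_of_lyapunov_le hconst.C₁_pos hcomp hconst.one_le_A hβ hd hV
  rw [← mul_assoc, Real.sqrt_mul' _ (sq_nonneg E), Real.sqrt_sq hE] at hσ
  have hq' : ‖S.zeta1 t‖ ≤ 2 * B * E := by
    refine hq.trans ?_
    rw [← mul_assoc]
    exact mul_le_mul_of_nonneg_left (pow_le_of_le_one hE hE' two_ne_zero) (by positivity)
  have hp' : ∀ i, |S.pHat g d ks t i| ≤ √(2 * b * B) * E := fun i => by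
    have hβi := hβ i
    have hpi := hp i
    rw [div_le_iff₀ (by positivity)] at hpi
    rw [← Real.sqrt_sq hE, ← Real.sqrt_mul' _ (sq_nonneg E)]
    refine Real.abs_le_sqrt (hpi.trans ?_)
    calc B * E ^ 2 * (2 * β i) ≤ B * E ^ 2 * (2 * b) := by gcongr; exact hb i
      _ = 2 * b * B * E ^ 2 := by ring
  have hσ0 : 0 ≤ √(C₁ * B) * E := by positivity
  have hq0 : 0 ≤ 2 * B * E := by positivity
  have hp0 : 0 ≤ √(2 * b * B) * E := by positivity
  have hσ1 : √(C₁ * B) * E ≤ √(C₁ * B) := mul_le_of_le_one_right (Real.sqrt_nonneg _) hE'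
  have hq1 : 2 * B * E ≤ 2 * B := mul_le_of_le_one_right (by positivity) hE'
  refine hS.norm_error_le ht hJ hL.nonneg (fun i => zero_le_one.trans (hgain.one_le_ks i))
    hgain.ks_le hK (by linarith) (by linarith) (fun i => by linarith [hp' i]) fun i => ?_
  refine (abs_gInc_le (by linarith [hconst.radius_le]) hL i).trans
    (mul_le_mul_of_nonneg_left (by linarith) hL.nonneg)

end Trajectory.IsSolution

theorem isExponentiallyAttracting_of_gains (hconst : DesignConstants m C C₁ A B R μ κ)
    (hcomp : SeekingComparison θbar C₁) (hL : LocalBounds f g xs R Λ)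
    (hgain : ObserverGains Λ K θ ks c) (hf : ∀ i, ContDiff ℝ 2 (f i))
    (hg : ∀ i, ContDiff ℝ 1 (g i)) (hd : ∀ i, ContDiffOn ℝ 2 (d i) (Ici t₀)) (hm : 0 < m)
    (hmono : ∀ x z : Fin N → ℝ, m * ((x - z) ⬝ᵥ (x - z)) ≤
      (x - z) ⬝ᵥ (pseudoGradient f x - pseudoGradient f z))
    (hxs : pseudoGradient f xs = 0) (hseek : SeekingDissipation a θbar θ m Λ C)
    (hobs : ObserverDissipation β M B (2 * Λ + K + 2 * Λ ^ 2) μ) (hK : 0 ≤ K)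
    (hβ : ∀ i, 0 < β i) (hβM : ∀ i, 2 * M ≤ β i) (hβv : ∀ i, (1 + Λ) ^ 2 * v ≤ β i)
    (hM : ∀ i, ∀ t ∈ Ici t₀, |derivWithin (d i) (Ici t₀) t| ≤ M ∧
      |iteratedDerivWithin 2 (d i) (Ici t₀) t| ≤ M)
    (hv : 4 * C₁ * v ^ 2 + 2 * N * v * A < B) (hR : 5 * v ≤ R) :
    IsExponentiallyAttracting f g d a θbar θ ks c β xs t₀ v := by
  obtain ⟨b, hb⟩ := Finite.exists_le β
  refine ⟨κ / 2, half_pos hconst.κ_pos,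
    √(Fintype.card (Fin N ⊕ Fin N ⊕ Fin N ⊕ (Fin N × Fin N) ⊕ Fin N)) *
      ((2 + Λ + K) * (√(C₁ * B) + 2 * B + √(2 * b * B))),
    fun J S hleast hord hJ hS h0 t ht => ?_⟩
  have htt₀ : t₀ ≤ t := hleast.2 ht
  have hdβ : ∀ τ ∈ Ici t₀, ∀ i, 2 * |derivWithin (d i) (Ici t₀) τ| ≤ β i := fun τ hτ i => by
    linarith [(hM i τ hτ).1, hβM i]
  have hV₀ := Trajectory.lyapunov_nonneg (S := S) (g := g) (xs := xs) (ks := ks) hconst.C₁_pos hcomp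
    hconst.one_le_A hβ (hdβ t₀ self_mem_Ici)
  have hVB := (hS.lyapunov_le_of_norm_error_le hleast.1 hJ (zero_le_one.trans hconst.one_le_A)
    hconst.C₁_pos.le hcomp hL h0 hR hβ hβv (hdβ t₀ self_mem_Ici)).trans_lt hv
  have hdecay := (hS.mono (hord.out hleast.1 ht)).lyapunov_le_mul_exp htt₀ hf hg hd
    hconst.κ_pos.le hV₀ hVB fun τ hτ s hs hV => Trajectory.lyapunovRate_le hconst hcomp hL hgain hm
      hmono hxs hseek hobs hβ hβM (fun i => hM i τ hτ) hs hV
  have hexp : Real.exp (-κ * (t - t₀)) = Real.exp (-(κ / 2) * (t - t₀)) ^ 2 := by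
    rw [← Real.exp_nat_mul]
    push_cast
    ring_nf
  have hEone : Real.exp (-(κ / 2) * (t - t₀)) ≤ 1 := Real.exp_le_one_iff.2
    (mul_nonpos_of_nonpos_of_nonneg (by linarith [hconst.κ_pos]) (sub_nonneg.2 htt₀))
  refine (hS.norm_error_le_of_lyapunov_le ht hJ hconst hcomp hL (hV₀.trans hVB.le) hgain hK hβ hb
    (hdβ t htt₀) (Real.exp_nonneg _) hEone (hdecay.trans ?_)).trans_eq (by ring)
  rw [hexp]
  exact mul_le_mul_of_nonneg_right hVB.le (by positivity)

theorem eventually_isExponentiallyAttracting (hN : 2 ≤ N) (ha : IsUndirectedConnected a)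
    (hθbar : ∀ i j, 0 < θbar i j) (hf : ∀ i, ContDiff ℝ 2 (f i)) (hg : ∀ i, ContDiff ℝ 1 (g i))
    (hd : ∀ i, ContDiffOn ℝ 2 (d i) (Ici t₀))
    (hdb : ∀ i, ∃ M, ∀ t ∈ Ici t₀, |derivWithin (d i) (Ici t₀) t| ≤ M ∧
      |iteratedDerivWithin 2 (d i) (Ici t₀) t| ≤ M) (hm : 0 < m)
    (hmono : ∀ x z : Fin N → ℝ, m * ((x - z) ⬝ᵥ (x - z)) ≤
      (x - z) ⬝ᵥ (pseudoGradient f x - pseudoGradient f z))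
    (hxs : pseudoGradient f xs = 0) (hv : 0 ≤ v) :
    ∀ᶠ θ in atTop, ∀ ks : Fin N → ℝ, (∀ i, 1 ≤ ks i) →
      ∀ᶠ c₀ in atTop, ∀ c : Fin N → ℝ, (∀ i, c₀ ≤ c i) →
        ∀ᶠ b in atTop, ∀ β : Fin N → ℝ, (∀ i, b ≤ β i) →
          IsExponentiallyAttracting f g d a θbar θ ks c β xs t₀ v := by
  have : Nonempty (Fin N) := ⟨⟨0, by omega⟩⟩
  obtain ⟨C, hC, hseek⟩ := exists_eventually_seekingDissipation hN ha hθbar hm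
  obtain ⟨C₁, hC₁, hcomp⟩ := exists_seekingComparison hθbar
  obtain ⟨A, B, R, μ, κ, hconst, hAB, hR⟩ := exists_designConstants (b₀ := 4 * C₁ * v ^ 2)
    (b₁ := 2 * N * v) hm hC.le hC₁ (by positivity) (by positivity) (5 * v)
  obtain ⟨Λ, hL⟩ := exists_localBounds hf hg xs R
  choose M' hM' using hdb
  obtain ⟨M, hM⟩ := Finite.exists_le M'
  filter_upwards [hseek Λ] with θ hθ ks hks
  obtain ⟨K, hK⟩ := Finite.exists_le ks
  have hK0 : 0 ≤ K := zero_le_one.trans ((hks ⟨0, by omega⟩).trans (hK _))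
  filter_upwards [eventually_ge_atTop K, eventually_ge_atTop θ, eventually_ge_atTop (4 * N * Λ)]
    with c₀ hcK hcθ hcΛ c hc
  have hgain : ObserverGains Λ K θ ks c := ⟨hks, hK, fun i => (hK i).trans (hcK.trans (hc i)),
    fun i => hcθ.trans (hc i), fun i => hcΛ.trans (hc i)⟩
  filter_upwards [
    eventually_observerDissipation (ι := Fin N) hconst.μ_pos M B (2 * Λ + K + 2 * Λ ^ 2),
    eventually_gt_atTop 0, eventually_ge_atTop (2 * M), eventually_ge_atTop ((1 + Λ) ^ 2 * v)]
    with b hobs hb hbM hbv β hβ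
  exact isExponentiallyAttracting_of_gains hconst hcomp hL hgain hf hg hd hm hmono hxs hθ
    (hobs β hβ) hK0 (fun i => hb.trans_le (hβ i)) (fun i => hbM.trans (hβ i))
    (fun i => hbv.trans (hβ i)) (fun i t ht => ⟨(hM' i t ht).1.trans (hM i),
      (hM' i t ht).2.trans (hM i)⟩) hAB hR

end ClosedLoop

end RISE

theorem theorem2_general {N : ℕ} (hN : 2 ≤ N)
    (f g : Fin N → (Fin N → ℝ) → ℝ) (d : Fin N → ℝ → ℝ)
    (a θbar : Matrix (Fin N) (Fin N) ℝ) (t₀ : ℝ)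
    (hf : ∀ i, ContDiff ℝ 2 (f i))
    (hmono : ∃ m : ℝ, 0 < m ∧ ∀ x z : Fin N → ℝ,
      m * ((x - z) ⬝ᵥ (x - z)) ≤
        (x - z) ⬝ᵥ (RISE.pseudoGradient f x - RISE.pseudoGradient f z))
    (ha : RISE.IsUndirectedConnected a)
    (hg : ∀ i, ContDiff ℝ 1 (g i))
    (hd : ∀ i, ContDiffOn ℝ 2 (d i) (Set.Ici t₀))
    (hdb : ∀ i, ∃ M : ℝ, ∀ t ∈ Set.Ici t₀,
      |derivWithin (d i) (Set.Ici t₀) t| ≤ M ∧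
      |iteratedDerivWithin 2 (d i) (Set.Ici t₀) t| ≤ M)
    (hθbar : ∀ i j, 0 < θbar i j) :
    (∃! xs, RISE.IsNash f xs) ∧
    ∀ xs, RISE.IsNash f xs →
      ∀ v₁ : ℝ, 0 < v₁ →
      ∃ θs : ℝ, 0 < θs ∧ ∀ θ : ℝ, θs < θ →
      ∃ kr : ℝ, 0 < kr ∧ ∀ ks : Fin N → ℝ, (∀ i, kr < ks i) →
      ∃ cr : ℝ, 0 < cr ∧ ∀ c : Fin N → ℝ, (∀ i, cr < c i) →
      ∃ βr : ℝ, 0 < βr ∧ ∀ β : Fin N → ℝ, (∀ i, βr < β i) →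
        (∀ (T : ℝ), t₀ < T → ∀ S : RISE.Trajectory N,
          S.IsSolution f g d a θbar θ ks c β t₀ (Set.Ico t₀ T) →
          ‖S.error g d xs c (Set.Ico t₀ T) t₀‖ ≤ v₁ →
          ∃ C : ℝ, ∀ t ∈ Set.Ico t₀ T, ‖S.error g d xs c (Set.Ico t₀ T) t‖ ≤ C) ∧
        (∀ S : RISE.Trajectory N,
          S.IsSolution f g d a θbar θ ks c β t₀ (Set.Ici t₀) →
          ‖S.error g d xs c (Set.Ici t₀) t₀‖ ≤ v₁ →
          Filter.Tendsto (fun t => ‖S.error g d xs c (Set.Ici t₀) t‖) Filter.atTop (nhds 0)) := by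
  obtain ⟨m, hm, hmono⟩ := hmono
  refine ⟨RISE.existsUnique_isNash hf hm hmono, fun xs hxs v₁ hv₁ => ?_⟩
  have hzero := hxs.pseudoGradient_eq_zero fun i => (hf i).differentiable two_ne_zero
  obtain ⟨θs, hθs⟩ := ((RISE.eventually_isExponentiallyAttracting hN ha hθbar hf hg hd hdb hm hmono
    hzero hv₁.le).and (Filter.eventually_gt_atTop 0)).exists_forall_of_atTop
  refine ⟨θs, (hθs θs le_rfl).2, fun θ hθ => ⟨1, one_pos, fun ks hks => ?_⟩⟩
  obtain ⟨cr, hc, hcr⟩ := (((hθs θ hθ.le).1 ks fun i => (hks i).le).and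
    (Filter.eventually_gt_atTop 0)).exists
  refine ⟨cr, hcr, fun c hcc => ?_⟩
  obtain ⟨βr, hβ, hβr⟩ := ((hc c fun i => (hcc i).le).and (Filter.eventually_gt_atTop 0)).exists
  refine ⟨βr, hβr, fun β hββ => ?_⟩
  have hattr := hβ β fun i => (hββ i).le
  exact ⟨fun T hT S hS hv => hattr.exists_norm_error_le hT hS hv,
    fun S hS hv => hattr.tendsto_norm_error hS hv⟩

theorem theorem2 {N : ℕ} (hN : 2 ≤ N)
    (f g : Fin N → (Fin N → ℝ) → ℝ) (d : Fin N → ℝ → ℝ)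
    (a θbar : Matrix (Fin N) (Fin N) ℝ) (t₀ : ℝ)
    (hf : ∀ i, ContDiff ℝ 2 (f i))
    (hmono : ∃ m : ℝ, 0 < m ∧ ∀ x z : Fin N → ℝ,
      m * ((x - z) ⬝ᵥ (x - z)) ≤
        (x - z) ⬝ᵥ (RISE.pseudoGradient f x - RISE.pseudoGradient f z))
    (ha : RISE.IsUndirectedConnected a)
    (hg : ∀ i, ContDiff ℝ 2 (g i))
    (hd : ∀ i, ContDiffOn ℝ 2 (d i) (Set.Ici t₀))
    (hdb : ∀ i, ∃ M : ℝ, ∀ t ∈ Set.Ici t₀,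
      |derivWithin (d i) (Set.Ici t₀) t| ≤ M ∧
      |iteratedDerivWithin 2 (d i) (Set.Ici t₀) t| ≤ M)
    (hθbar : ∀ i j, 0 < θbar i j) :
    (∃! xs, RISE.IsNash f xs) ∧
    ∀ xs, RISE.IsNash f xs →
      ∀ v₁ : ℝ, 0 < v₁ →
      ∃ θs : ℝ, 0 < θs ∧ ∀ θ : ℝ, θs < θ →
      ∃ kr : ℝ, 0 < kr ∧ ∀ ks : Fin N → ℝ, (∀ i, kr < ks i) →
      ∃ cr : ℝ, 0 < cr ∧ ∀ c : Fin N → ℝ, (∀ i, cr < c i) →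
      ∃ βr : ℝ, 0 < βr ∧ ∀ β : Fin N → ℝ, (∀ i, βr < β i) →
        -- no solution escapes in finite time
        (∀ (T : ℝ), t₀ < T → ∀ S : RISE.Trajectory N,
          S.IsSolution f g d a θbar θ ks c β t₀ (Set.Ico t₀ T) →
          ‖S.error g d xs c (Set.Ico t₀ T) t₀‖ ≤ v₁ →
          ∃ C : ℝ, ∀ t ∈ Set.Ico t₀ T, ‖S.error g d xs c (Set.Ico t₀ T) t‖ ≤ C) ∧
        -- the error tends to zero along every solution
        (∀ S : RISE.Trajectory N,
          S.IsSolution f g d a θbar θ ks c β t₀ (Set.Ici t₀) →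
          ‖S.error g d xs c (Set.Ici t₀) t₀‖ ≤ v₁ →
          Filter.Tendsto (fun t => ‖S.error g d xs c (Set.Ici t₀) t‖) Filter.atTop (nhds 0)) :=
  theorem2_general hN f g d a θbar t₀ hf hmono ha (fun i => (hg i).of_le one_le_two) hd hdb hθbar
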